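/- Let $0<q<1$ and, for complex $u$, put $(u;q)_n=\prod_{k=0}^{n-1}(1-uq^k)$ for $n\in\{0,1,2,\dots\}$, $(u;q)_\infty=\prod_{k\ge 0}(1-uq^k)$, $(u;q)_\beta=(u;q)_\infty/(uq^{\beta};q)_\infty$ for real $\beta>0$, and $(u_1,\dots,u_m;q)_\bullet=(u_1;q)_\bullet\cdots(u_m;q)_\bullet$. Let $$h(\cos\theta;u_1,\dots,u_m)=\prod_{j=1}^m (u_je^{i\theta},u_je^{-i\theta};q)_\infty,$$ $${}_4\phi_3\left[\begin{matrix}a_1,a_2,a_3,a_4\\ b_1,b_2,b_3\end{matrix};q,z\right]=\sum_{n=0}^\infty\frac{(a_1,a_2,a_3,a_4;q)_n}{(q,b_1,b_2,b_3;q)_n}z^n .$$ Let $\alpha>0$ be real and let $a,b,c,d,x$ be complex numbers with $\max\{|a|,|b|,|c|,|d|\}<1$, $a\ne 0$, $0<|x|<1$, and $aq^{\alpha+n}\ne x$ for all integers $n\ge 0$ (for example, $0<a<x<1$); powers of $x$ are principal values. Then for every $\theta\in[0,\pi]$ the series $$S(\theta)=\sum_{k=0}^\infty \frac{x^{\alpha+k}(a/x;q)_{\alpha+k}}{a^k(q;q)_{\alpha+k}}\;{}_4\phi_3\left[\begin{matrix}q^{-k},abcd,ae^{i\theta},ae^{-i\theta}\\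 ab,ac,ad\end{matrix};q,q\right]$$ converges absolutely, the function $\theta\mapsto \frac{h(\cos2\theta;1)}{h(\cos\theta;a,b,c,d)}S(\theta)$ is integrable on $[0,\pi]$, and $$\int_0^\pi\frac{h(\cos2\theta;1)}{h(\cos\theta;a,b,c,d)}\,S(\theta)\,d\theta=\frac{2\pi(abcd;q)_\infty}{(q,ab,ac,ad,bc,bd,cd;q)_\infty}\cdot\frac{x^\alpha(a/x;q)_\alpha}{(q;q)_\alpha}.$$ -/

import Mathlib

noncomputable section

/-- The infinite `q`-shifted factorial `(a;q)_∞ = ∏_{k ≥ 0} (1 - a q^k)`. -/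
def qPochInf (q a : ℂ) : ℂ := ∏' k : ℕ, (1 - a * q ^ k)

/-- The finite `q`-shifted factorial `(a;q)_n = ∏_{k < n} (1 - a q^k)`. -/
def qPoch (q a : ℂ) (n : ℕ) : ℂ := ∏ k ∈ Finset.range n, (1 - a * q ^ k)

/-- The `q`-shifted factorial of general order, `(a;q)_β = (a;q)_∞ / (a q^β;q)_∞`. -/
def qPochGen (q a β : ℂ) : ℂ := qPochInf q a / qPochInf q (a * q ^ β)

/-- The compact notation `(a₁,…,a_m;q)_∞ = (a₁;q)_∞ ⋯ (a_m;q)_∞`. -/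
def qPochInfList (q : ℂ) (as : List ℂ) : ℂ := (as.map (qPochInf q)).prod

/-- The compact notation `(a₁,…,a_m;q)_n = (a₁;q)_n ⋯ (a_m;q)_n`. -/
def qPochList (q : ℂ) (as : List ℂ) (n : ℕ) : ℂ := (as.map fun a => qPoch q a n).prod

/-- The basic hypergeometric series `ᵣφₛ(a₁,…,a_r; b₁,…,b_s; q, z)`,
where `r` and `s` are the lengths of the two lists. -/
def basicHypergeometric (as bs : List ℂ) (q z : ℂ) : ℂ :=
  ∑' n : ℕ, qPochList q as n / qPochList q (q :: bs) n *
    ((-1) ^ n * q ^ n.choose 2) ^ (1 + (bs.length : ℤ) - (as.length : ℤ)) * z ^ n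

/-- `h(cos θ; a₁,…,a_m) = ∏ᵢ (aᵢ e^{iθ}, aᵢ e^{-iθ}; q)_∞`, as a function of the angle `θ`. -/
def askeyWilsonH (q : ℂ) (θ : ℝ) (as : List ℂ) : ℂ :=
  (as.map fun a => qPochInfList q
    [a * Complex.exp (Complex.I * θ), a * Complex.exp (-(Complex.I * θ))]).prod

/-- The `k`-th term
`x^{α+k} (a/x;q)_{α+k} / (a^k (q;q)_{α+k}) ·
  ₄φ₃(q^{-k}, abcd, a e^{iθ}, a e^{-iθ}; ab, ac, ad; q, q)`. -/
def fractionalAskeyWilsonTerm (q : ℂ) (α : ℝ) (x a b c d : ℂ) (θ : ℝ) (k : ℕ) : ℂ :=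
  x ^ ((α : ℂ) + k) * qPochGen q (a / x) (α + k) / (a ^ k * qPochGen q q (α + k)) *
    basicHypergeometric
      [q ^ (-(k : ℤ)), a * b * c * d,
        a * Complex.exp (Complex.I * θ), a * Complex.exp (-(Complex.I * θ))]
      [a * b, a * c, a * d] q q

end

/-! Write `z = e^{iθ}`, let `w_a(z)` be the Askey-Wilson weight and `φ_k(z)` the terminating `₄φ₃`.
Only the `k = 0` term of the series survives integration against `w_a`.

Orthogonality: `(az, a/z; q)_n w_a = w_{aq^n}`, so the Askey-Wilson integral evaluates `∫ w_a φ_k`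
term by term. The other factors of the `n`-th term cancel, leaving `∑ (q^{-k};q)_n q^n / (q;q)_n`,
which vanishes for `k ≥ 1` by the terminating `q`-binomial theorem
(`integral_askeyWilsonKernel_mul_terminatingPhi`).

Interchange of sum and integral: the coefficient of `φ_k` is `O(|x/a|^k)`. Moreover `φ_k` is a
normalized `k`-th `q`-difference at `a` of a function holomorphic in the unit disc, hence
`O((|a|/ρ)^k)` uniformly on `|z| = 1` whenever `|a| < ρ < 1` (`exists_norm_terminatingPhi_le`). With
`|x| < ρ` as well, the series is dominated by a geometric one.

The Askey-Wilson integral itself (`integral_askeyWilsonKernel`): shifting a contour from `|z| = 1`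
to `|z| = q` yields a functional equation under `a ↦ aq`. The quotient of the integral by its
expected value is therefore invariant under scaling all parameters by `q`, and by continuity it
equals its value at zero parameters. The parameters `q, -q, √q, -√q`, for which the weight is a
Laurent polynomial, determine that value. -/

noncomputable section qPochInf

open Filter Topology

variable {q : ℂ}

/-! ### Infinite and finite `q`-shifted factorials. -/

theorem summable_norm_mul_pow (hq : ‖q‖ < 1) (a : ℂ) : Summable fun k : ℕ => ‖-(a * q ^ k)‖ := by
  simp only [norm_neg, norm_mul, norm_pow]
  exact (summable_geometric_of_lt_one (norm_nonneg _) hq).mul_left _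

theorem multipliable_qPochInf (hq : ‖q‖ < 1) (a : ℂ) :
    Multipliable fun k : ℕ => 1 - a * q ^ k := by
  simpa [sub_eq_add_neg] using multipliable_one_add_of_summable (summable_norm_mul_pow hq a)

theorem qPochInf_ne_zero (hq : ‖q‖ < 1) {a : ℂ} (h : ∀ k : ℕ, a * q ^ k ≠ 1) :
    qPochInf q a ≠ 0 := by
  have := tprod_one_add_ne_zero_of_summable (f := fun k : ℕ => -(a * q ^ k))
    (fun k => by rw [← sub_eq_add_neg]; exact sub_ne_zero.2 (h k).symm) (summable_norm_mul_pow hq a)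
  simpa [qPochInf, sub_eq_add_neg] using this

theorem mul_pow_ne_one_of_norm_lt (hq : ‖q‖ < 1) {a : ℂ} (ha : ‖a‖ < 1) (k : ℕ) :
    a * q ^ k ≠ 1 := by
  intro h
  have : ‖a * q ^ k‖ < 1 := by
    rw [norm_mul, norm_pow]
    exact mul_lt_one_of_nonneg_of_lt_one_left (norm_nonneg _) ha
      (pow_le_one₀ (norm_nonneg _) hq.le)
  simp [h] at this

theorem qPochInf_ne_zero_of_norm_lt (hq : ‖q‖ < 1) {a : ℂ} (ha : ‖a‖ < 1) :
    qPochInf q a ≠ 0 :=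
  qPochInf_ne_zero hq (mul_pow_ne_one_of_norm_lt hq ha)

theorem qPoch_ne_zero_of_norm_lt (hq : ‖q‖ < 1) {a : ℂ} (ha : ‖a‖ < 1) (n : ℕ) :
    qPoch q a n ≠ 0 :=
  Finset.prod_ne_zero_iff.2 fun k _ => sub_ne_zero.2 (mul_pow_ne_one_of_norm_lt hq ha k).symm

/-- The product converges locally uniformly on the ball of radius `‖a‖ + 1`, with majorant `(‖a‖ +
1) ‖q‖^k`, so the limit of the polynomial partial products is holomorphic there. -/
theorem differentiable_qPochInf (hq : ‖q‖ < 1) : Differentiable ℂ (qPochInf q) := by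
  intro a
  have hb : IsOpen (Metric.ball (0 : ℂ) (‖a‖ + 1)) := Metric.isOpen_ball
  have h := Summable.hasProdLocallyUniformlyOn_nat_one_add (f := fun (k : ℕ) (t : ℂ) => -(t * q ^ k))
    hb ((summable_geometric_of_lt_one (norm_nonneg q) hq).mul_left (‖a‖ + 1))
    (Eventually.of_forall fun k t ht => by
      rw [norm_neg, norm_mul, norm_pow]
      gcongr
      simpa using (Metric.mem_ball.1 ht).le)
    (fun k => by fun_prop)
  have hd : DifferentiableOn ℂ (fun t => ∏' k : ℕ, (1 + -(t * q ^ k)))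
      (Metric.ball (0 : ℂ) (‖a‖ + 1)) :=
    TendstoLocallyUniformlyOn.differentiableOn (hasProdLocallyUniformlyOn_iff_tendstoLocallyUniformlyOn.1 h)
      (Eventually.of_forall fun s => by
        apply DifferentiableOn.fun_finsetProd
        intro i _
        fun_prop) hb
  have := hd.differentiableAt (hb.mem_nhds (by simp : a ∈ Metric.ball (0 : ℂ) (‖a‖ + 1)))
  simpa [qPochInf, sub_eq_add_neg] using! this

theorem continuous_qPochInf (hq : ‖q‖ < 1) : Continuous (qPochInf q) :=
  (differentiable_qPochInf hq).continuous

@[simp]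
theorem qPochInf_zero (q : ℂ) : qPochInf q 0 = 1 := by simp [qPochInf]

@[simp]
theorem qPoch_zero_right (q a : ℂ) : qPoch q a 0 = 1 := by simp [qPoch]

theorem qPoch_succ (q a : ℂ) (n : ℕ) : qPoch q a (n + 1) = qPoch q a n * (1 - a * q ^ n) := by
  simp [qPoch, Finset.prod_range_succ]

theorem qPoch_succ' (q a : ℂ) (n : ℕ) : qPoch q a (n + 1) = (1 - a) * qPoch q (a * q) n := by
  simp only [qPoch, Finset.prod_range_succ', pow_succ', mul_assoc]
  simp [mul_comm (1 - a)]

theorem qPochInf_eq_one_sub_mul (hq : ‖q‖ < 1) (a : ℂ) :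
    qPochInf q a = (1 - a) * qPochInf q (a * q) := by
  have h : Multipliable fun k : ℕ => 1 - a * q ^ (k + 1) := by
    simpa [pow_succ', mul_assoc] using multipliable_qPochInf hq (a * q)
  have h' := tprod_eq_zero_mul' (f := fun k : ℕ => 1 - a * q ^ k) h
  simp only [pow_zero, mul_one, pow_succ', ← mul_assoc] at h'
  exact h'

theorem qPochInf_eq_qPoch_mul (hq : ‖q‖ < 1) (a : ℂ) (n : ℕ) :
    qPochInf q a = qPoch q a n * qPochInf q (a * q ^ n) := by
  induction n with
  | zero => simp
  | succ n ih =>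
    rw [ih, qPochInf_eq_one_sub_mul hq (a * q ^ n), qPoch_succ, pow_succ]
    ring_nf

theorem continuous_qPoch (q : ℂ) (n : ℕ) : Continuous fun a => qPoch q a n := by
  unfold qPoch
  fun_prop

/-- This and `qPochInf_sq_mul` change the base from `q` to `q ^ 2`; they serve the explicit
parameters that fix the constant in the Askey-Wilson integral. -/
theorem qPochInf_mul_neg (hq : ‖q‖ < 1) (a : ℂ) :
    qPochInf q a * qPochInf q (-a) = qPochInf (q ^ 2) (a ^ 2) := by
  rw [qPochInf, qPochInf, ← (multipliable_qPochInf hq a).tprod_mul (multipliable_qPochInf hq (-a)),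
    qPochInf]
  congr 1
  ext k
  ring

theorem norm_sq_lt_one (hq : ‖q‖ < 1) : ‖q ^ 2‖ < 1 := by
  rw [norm_pow]
  exact pow_lt_one₀ (norm_nonneg _) hq two_ne_zero

theorem qPochInf_sq_mul (hq : ‖q‖ < 1) (a : ℂ) :
    qPochInf (q ^ 2) a * qPochInf (q ^ 2) (a * q) = qPochInf q a := by
  have h1 : Multipliable fun k : ℕ => 1 - a * q ^ (2 * k) := by
    simpa [pow_mul] using multipliable_qPochInf (norm_sq_lt_one hq) a
  have h2 : Multipliable fun k : ℕ => 1 - a * q ^ (2 * k + 1) := by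
    simpa [pow_mul, pow_succ', mul_assoc] using multipliable_qPochInf (norm_sq_lt_one hq) (a * q)
  have := tprod_even_mul_odd (f := fun k : ℕ => 1 - a * q ^ k) h1 h2
  rw [qPochInf, qPochInf, qPochInf, ← this]
  simp only [pow_mul, pow_succ', mul_assoc]

theorem exists_norm_qPochInf_le (hq : ‖q‖ < 1) (r : ℝ) :
    ∃ C, 0 < C ∧ ∀ u : ℂ, ‖u‖ ≤ r → ‖qPochInf q u‖ ≤ C := by
  obtain ⟨C, hC⟩ := (isCompact_closedBall (0 : ℂ) r).exists_bound_of_continuousOn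
    (continuous_qPochInf hq).continuousOn
  exact ⟨max C 1, by positivity, fun u hu => (hC u (by simpa using hu)).trans (le_max_left _ _)⟩

theorem exists_norm_inv_qPochInf_le (hq : ‖q‖ < 1) {r : ℝ} (hr : r < 1) :
    ∃ C, 0 < C ∧ ∀ u : ℂ, ‖u‖ ≤ r → ‖(qPochInf q u)⁻¹‖ ≤ C := by
  obtain ⟨C, hC⟩ := (isCompact_closedBall (0 : ℂ) r).exists_bound_of_continuousOn
    (f := fun u => (qPochInf q u)⁻¹)
    ((continuous_qPochInf hq).continuousOn.inv₀ fun u hu =>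
      qPochInf_ne_zero_of_norm_lt hq ((by simpa using hu : ‖u‖ ≤ r).trans_lt hr))
  exact ⟨max C 1, by positivity, fun u hu => (hC u (by simpa using hu)).trans (le_max_left _ _)⟩

end qPochInf

/-! ### The Askey-Wilson weight and the contour shift. -/

noncomputable section AskeyWilsonIntegral

open Filter Topology

/-- The factor `(a z, a / z; q)_∞` of the Askey-Wilson weight. -/
def askeyWilsonFactor (q a z : ℂ) : ℂ := qPochInf q (a * z) * qPochInf q (a * z⁻¹)

/-- The Askey-Wilson weight as a function of `z = e^{iθ}`. -/
def askeyWilsonKernel (q a b c d z : ℂ) : ℂ :=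
  qPochInf q (z ^ 2) * qPochInf q (z⁻¹ ^ 2) /
    (askeyWilsonFactor q a z * askeyWilsonFactor q b z * askeyWilsonFactor q c z *
      askeyWilsonFactor q d z)

/-- The integral of the Askey-Wilson weight over the whole unit circle. -/
def askeyWilsonIntegral (q a b c d : ℂ) : ℂ :=
  ∫ θ in (0 : ℝ)..2 * Real.pi, askeyWilsonKernel q a b c d (circleMap 0 1 θ)

/-- A function which is analytic in `|q| ≤ |z| ≤ 1` and whose symmetrization in `z ↦ 1 / z` is the
Askey-Wilson weight multiplied by a Laurent polynomial. -/
def askeyWilsonPrimitive (q a b c d z : ℂ) : ℂ :=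
  z * (qPochInf q (z ^ 2) * qPochInf q (q * z⁻¹ ^ 2)) /
    ((qPochInf q (a * z) * qPochInf q (a * q * z⁻¹)) *
      (qPochInf q (b * z) * qPochInf q (b * q * z⁻¹)) *
      (qPochInf q (c * z) * qPochInf q (c * q * z⁻¹)) *
      (qPochInf q (d * z) * qPochInf q (d * q * z⁻¹)))

variable {q a b c d : ℂ}

theorem askeyWilsonFactor_ne_zero (hq : ‖q‖ < 1) (ha : ‖a‖ < 1) {z : ℂ} (hz : ‖z‖ = 1) :
    askeyWilsonFactor q a z ≠ 0 :=
  mul_ne_zero (qPochInf_ne_zero_of_norm_lt hq (by simpa [hz]))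
    (qPochInf_ne_zero_of_norm_lt hq (by simpa [hz]))

theorem askeyWilsonFactor_eq (hq : ‖q‖ < 1) (a z : ℂ) :
    askeyWilsonFactor q a z =
      (1 - a * z) * (1 - a * z⁻¹) * askeyWilsonFactor q (a * q) z := by
  rw [askeyWilsonFactor, askeyWilsonFactor, qPochInf_eq_one_sub_mul hq (a * z),
    qPochInf_eq_one_sub_mul hq (a * z⁻¹)]
  ring_nf

theorem norm_mul_lt_one {u v : ℂ} (hu : ‖u‖ < 1) (hv : ‖v‖ ≤ 1) : ‖u * v‖ < 1 := by
  rw [norm_mul]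
  exact mul_lt_one_of_nonneg_of_lt_one_left (norm_nonneg _) hu hv

theorem one_sub_ne_zero_of_norm_lt {u : ℂ} (hu : ‖u‖ < 1) : 1 - u ≠ 0 := by
  intro h
  rw [sub_eq_zero] at h
  simp [← h] at hu

theorem askeyWilsonKernel_mul_right (hq : ‖q‖ < 1) (ha : ‖a‖ < 1) (b c d : ℂ) {z : ℂ}
    (hz : ‖z‖ = 1) :
    askeyWilsonKernel q (a * q) b c d z =
      (1 - a * z) * (1 - a * z⁻¹) * askeyWilsonKernel q a b c d z := by
  have h1 : 1 - a * z ≠ 0 := one_sub_ne_zero_of_norm_lt (by simpa [hz])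
  have h2 : 1 - a * z⁻¹ ≠ 0 := one_sub_ne_zero_of_norm_lt (by simpa [hz])
  rw [askeyWilsonKernel, askeyWilsonKernel, askeyWilsonFactor_eq hq a]
  generalize 1 - a * z = u at *
  generalize 1 - a * z⁻¹ = v at *
  rw [mul_div_assoc', show u * v * askeyWilsonFactor q (a * q) z * askeyWilsonFactor q b z *
    askeyWilsonFactor q c z * askeyWilsonFactor q d z = (u * v) *
    (askeyWilsonFactor q (a * q) z * askeyWilsonFactor q b z *
    askeyWilsonFactor q c z * askeyWilsonFactor q d z) by ring,
    mul_div_mul_left _ _ (mul_ne_zero h1 h2)]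

/-- Once the first factor is split off each product where needed, the three terms share the same
infinite products, and a rational identity in `z` remains. -/
theorem askeyWilsonPrimitive_add_inv (hq : ‖q‖ < 1) (ha : ‖a‖ < 1) (hb : ‖b‖ < 1) (hc : ‖c‖ < 1)
    (hd : ‖d‖ < 1) {z : ℂ} (hz : ‖z‖ = 1) :
    askeyWilsonPrimitive q a b c d z + askeyWilsonPrimitive q a b c d z⁻¹ =
      askeyWilsonKernel q a b c d z * ((1 - a * b * c * d) * (z + z⁻¹) -
        (a + b + c + d - (a * b * c + a * b * d + a * c * d + b * c * d))) := by
  have hz0 : z ≠ 0 := by rintro rfl; simp at hz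
  have key : ∀ u : ℂ, ‖u‖ < 1 → 1 - u * z ≠ 0 ∧ 1 - u * z⁻¹ ≠ 0 ∧
      qPochInf q (u * q * z) ≠ 0 ∧ qPochInf q (u * q * z⁻¹) ≠ 0 ∧
      qPochInf q (u * z) = (1 - u * z) * qPochInf q (u * q * z) ∧
      qPochInf q (u * z⁻¹) = (1 - u * z⁻¹) * qPochInf q (u * q * z⁻¹) := by
    intro u hu
    refine ⟨one_sub_ne_zero_of_norm_lt (by simpa [hz]), one_sub_ne_zero_of_norm_lt (by simpa [hz]),
      ?_, ?_, ?_, ?_⟩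
    · exact qPochInf_ne_zero_of_norm_lt hq (by simpa [hz] using norm_mul_lt_one hu hq.le)
    · exact qPochInf_ne_zero_of_norm_lt hq (by simpa [hz] using norm_mul_lt_one hu hq.le)
    · rw [qPochInf_eq_one_sub_mul hq (u * z)]
      ring_nf
    · rw [qPochInf_eq_one_sub_mul hq (u * z⁻¹)]
      ring_nf
  obtain ⟨a1, a2, a3, a4, a5, a6⟩ := key a ha
  obtain ⟨b1, b2, b3, b4, b5, b6⟩ := key b hb
  obtain ⟨c1, c2, c3, c4, c5, c6⟩ := key c hc
  obtain ⟨d1, d2, d3, d4, d5, d6⟩ := key d hd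
  have hA : qPochInf q (z ^ 2) = (1 - z ^ 2) * qPochInf q (q * z ^ 2) := by
    rw [qPochInf_eq_one_sub_mul hq, mul_comm q]
  have hB : qPochInf q (z⁻¹ ^ 2) = (1 - z⁻¹ ^ 2) * qPochInf q (q * z⁻¹ ^ 2) := by
    rw [qPochInf_eq_one_sub_mul hq, mul_comm q]
  simp only [askeyWilsonPrimitive, askeyWilsonKernel, askeyWilsonFactor, inv_inv, hA, hB,
    a5, a6, b5, b6, c5, c6, d5, d6]
  generalize qPochInf q (q * z ^ 2) = A
  generalize qPochInf q (q * z⁻¹ ^ 2) = B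
  generalize qPochInf q (a * q * z) = A1 at *
  generalize qPochInf q (a * q * z⁻¹) = A2 at *
  generalize qPochInf q (b * q * z) = B1 at *
  generalize qPochInf q (b * q * z⁻¹) = B2 at *
  generalize qPochInf q (c * q * z) = C1 at *
  generalize qPochInf q (c * q * z⁻¹) = C2 at *
  generalize qPochInf q (d * q * z) = D1 at *
  generalize qPochInf q (d * q * z⁻¹) = D2 at *
  clear hA hB key a5 a6 b5 b6 c5 c6 d5 d6
  generalize hUa : 1 - a * z = Ua at *
  generalize hVa : 1 - a * z⁻¹ = Va at *
  generalize hUb : 1 - b * z = Ub at *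
  generalize hVb : 1 - b * z⁻¹ = Vb at *
  generalize hUc : 1 - c * z = Uc at *
  generalize hVc : 1 - c * z⁻¹ = Vc at *
  generalize hUd : 1 - d * z = Ud at *
  generalize hVd : 1 - d * z⁻¹ = Vd at *
  -- The whole content of the lemma, free of infinite products.
  have e : z * (1 - z ^ 2) * (Va * Vb * Vc * Vd) + z⁻¹ * (1 - z⁻¹ ^ 2) * (Ua * Ub * Uc * Ud) =
      (1 - z ^ 2) * (1 - z⁻¹ ^ 2) * ((1 - a * b * c * d) * (z + z⁻¹) -
        (a + b + c + d - (a * b * c + a * b * d + a * c * d + b * c * d))) := by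
    subst hUa hUb hUc hUd hVa hVb hVc hVd
    field_simp
    ring
  generalize (1 - a * b * c * d) * (z + z⁻¹) -
        (a + b + c + d - (a * b * c + a * b * d + a * c * d + b * c * d)) = R at *
  clear hUa hUb hUc hUd hVa hVb hVc hVd
  generalize z⁻¹ = w at *
  field_simp
  linear_combination A * B * e

/-- At `q * z` and at `z⁻¹` the denominators agree up to the order of their factors; the sign comes
from `qz (1 - 1/(qz²)) = -z⁻¹ (1 - qz²)`. -/
theorem askeyWilsonPrimitive_mul (hq : ‖q‖ < 1) (hq0 : q ≠ 0) (a b c d : ℂ) {z : ℂ} (hz : z ≠ 0) :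
    askeyWilsonPrimitive q a b c d (q * z) = -askeyWilsonPrimitive q a b c d z⁻¹ := by
  have h1 : qPochInf q (q * (q * z)⁻¹ ^ 2) =
      (1 - q⁻¹ * z⁻¹ ^ 2) * qPochInf q (z⁻¹ ^ 2) := by
    rw [qPochInf_eq_one_sub_mul hq]
    congr 2 <;> field_simp
  have h2 : qPochInf q (q * z ^ 2) = (1 - q * z ^ 2) * qPochInf q ((q * z) ^ 2) := by
    rw [qPochInf_eq_one_sub_mul hq]
    ring_nf
  have h3 : ∀ u : ℂ, u * q * (q * z)⁻¹ = u * z⁻¹ := fun u => by field_simp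
  have h4 : ∀ u : ℂ, u * q * z = u * (q * z) := fun u => by ring
  simp only [askeyWilsonPrimitive, h1, inv_inv, h2, h3, h4]
  rw [← neg_div]
  congr 1
  · field_simp
    ring
  · ring

/-- Cauchy's theorem for `f(z)/z` on the annulus, since `dz / z = i dθ`. -/
theorem integral_circleMap_eq_of_differentiableAt_annulus {r : ℝ} (hr : 0 < r) (hr1 : r ≤ 1)
    {f : ℂ → ℂ} (hf : ∀ z : ℂ, r ≤ ‖z‖ → ‖z‖ ≤ 1 → DifferentiableAt ℂ f z) :
    ∫ θ in (0 : ℝ)..2 * Real.pi, f (circleMap 0 1 θ) =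
      ∫ θ in (0 : ℝ)..2 * Real.pi, f (circleMap 0 r θ) := by
  have h := Complex.circleIntegral_sub_center_inv_smul_eq_of_differentiable_on_annulus_off_countable
    (c := 0) hr hr1 (f := f) Set.countable_empty
    (fun z hz => (hf z (by simpa using hz.2) (by simpa using hz.1)).continuousAt.continuousWithinAt)
    (fun z hz => hf z (by simpa using (not_le.1 (mt Metric.mem_closedBall.2 hz.1.2)).le)
      (by simpa using (Metric.mem_ball.1 hz.1.1).le))
  have key : ∀ R : ℝ, 0 < R → (∮ z in C(0, R), (z - 0)⁻¹ • f z) =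
      Complex.I * ∫ θ in (0 : ℝ)..2 * Real.pi, f (circleMap 0 R θ) := by
    intro R hR
    rw [circleIntegral, ← intervalIntegral.integral_const_mul]
    congr 1
    ext θ
    have : circleMap 0 R θ ≠ 0 := circleMap_ne_center hR.ne'
    rw [deriv_circleMap, sub_zero, smul_eq_mul, smul_eq_mul]
    field_simp
  rw [key 1 one_pos, key r hr] at h
  exact mul_left_cancel₀ Complex.I_ne_zero h

theorem differentiableAt_askeyWilsonPrimitive (hq : ‖q‖ < 1) (hq0 : q ≠ 0) (ha : ‖a‖ < 1)
    (hb : ‖b‖ < 1) (hc : ‖c‖ < 1) (hd : ‖d‖ < 1) {z : ℂ} (hz : ‖q‖ ≤ ‖z‖) (hz1 : ‖z‖ ≤ 1) :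
    DifferentiableAt ℂ (askeyWilsonPrimitive q a b c d) z := by
  have hz0 : z ≠ 0 := norm_pos_iff.1 ((norm_pos_iff.2 hq0).trans_le hz)
  have hD := differentiable_qPochInf hq
  have hqz : ‖q * z⁻¹‖ ≤ 1 := by
    rw [norm_mul, norm_inv, ← div_eq_mul_inv]
    exact div_le_one_of_le₀ hz (norm_nonneg _)
  have key : ∀ u : ℂ, ‖u‖ < 1 → qPochInf q (u * z) * qPochInf q (u * q * z⁻¹) ≠ 0 := fun u hu =>
    mul_ne_zero (qPochInf_ne_zero_of_norm_lt hq (norm_mul_lt_one hu hz1))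
      (qPochInf_ne_zero_of_norm_lt hq (by rw [mul_assoc]; exact norm_mul_lt_one hu hqz))
  have hc : ∀ {g : ℂ → ℂ}, DifferentiableAt ℂ g z →
      DifferentiableAt ℂ (fun t => qPochInf q (g t)) z := fun hg => (hD _).comp z hg
  have hi : DifferentiableAt ℂ (fun t : ℂ => t⁻¹) z := differentiableAt_inv hz0
  have hp : ∀ u : ℂ, DifferentiableAt ℂ (fun t => qPochInf q (u * t) * qPochInf q (u * q * t⁻¹)) z :=
    fun u => (hc (differentiableAt_id.const_mul u)).mul (hc (hi.const_mul _))
  refine DifferentiableAt.div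
    (differentiableAt_id.mul ((hc (differentiableAt_id.pow 2)).mul (hc ((hi.pow 2).const_mul q))))
    ((((hp a).mul (hp b)).mul (hp c)).mul (hp d)) ?_
  exact mul_ne_zero (mul_ne_zero (mul_ne_zero (key a ha) (key b hb)) (key c ‹_›)) (key d hd)

end AskeyWilsonIntegral

/-! ### Evaluation of the Askey-Wilson integral. -/

noncomputable section AskeyWilsonEvaluation

open Filter Topology

variable {q a b c d : ℂ}

/-- Continuity of the Askey-Wilson weight on the unit circle, jointly in the parameters. -/
theorem Continuous.askeyWilsonKernel {X : Type*} [TopologicalSpace X] (hq : ‖q‖ < 1)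
    {a b c d z : X → ℂ} (ha : Continuous a) (hb : Continuous b) (hc : Continuous c)
    (hd : Continuous d) (hz : Continuous z) (ha1 : ∀ t, ‖a t‖ < 1) (hb1 : ∀ t, ‖b t‖ < 1)
    (hc1 : ∀ t, ‖c t‖ < 1) (hd1 : ∀ t, ‖d t‖ < 1) (hz1 : ∀ t, ‖z t‖ = 1) :
    Continuous fun t => askeyWilsonKernel q (a t) (b t) (c t) (d t) (z t) := by
  have hP := continuous_qPochInf hq
  have hi : Continuous fun t => (z t)⁻¹ := hz.inv₀ fun t h => by simpa [h] using hz1 t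
  have hf : ∀ {u : X → ℂ}, Continuous u → Continuous fun t => askeyWilsonFactor q (u t) (z t) :=
    fun hu => (hP.comp (hu.mul hz)).mul (hP.comp (hu.mul hi))
  refine Continuous.div ((hP.comp (hz.pow 2)).mul (hP.comp (hi.pow 2)))
    ((((hf ha).mul (hf hb)).mul (hf hc)).mul (hf hd)) fun t => ?_
  exact mul_ne_zero (mul_ne_zero (mul_ne_zero
    (askeyWilsonFactor_ne_zero hq (ha1 t) (hz1 t)) (askeyWilsonFactor_ne_zero hq (hb1 t) (hz1 t)))
    (askeyWilsonFactor_ne_zero hq (hc1 t) (hz1 t))) (askeyWilsonFactor_ne_zero hq (hd1 t) (hz1 t))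

theorem norm_circleMap_zero_one (θ : ℝ) : ‖circleMap 0 1 θ‖ = 1 := by simp

theorem circleMap_zero_one_ne_zero (θ : ℝ) : circleMap 0 1 θ ≠ 0 := circleMap_ne_center one_ne_zero

theorem continuous_askeyWilsonKernel_circleMap (hq : ‖q‖ < 1) (ha : ‖a‖ < 1) (hb : ‖b‖ < 1)
    (hc : ‖c‖ < 1) (hd : ‖d‖ < 1) :
    Continuous fun θ : ℝ => askeyWilsonKernel q a b c d (circleMap 0 1 θ) :=
  Continuous.askeyWilsonKernel hq continuous_const continuous_const continuous_const
    continuous_const (continuous_circleMap 0 1) (fun _ => ha) (fun _ => hb) (fun _ => hc)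
    (fun _ => hd) norm_circleMap_zero_one

/-- The integrand is `G(z) + G(1/z)` with `G` the `askeyWilsonPrimitive`. Moving `G` to `|z| = q`
and applying `G(qz) = -G(1/z)` makes the two integrals cancel. -/
theorem integral_askeyWilsonKernel_mul_eq_zero {q : ℝ} (hq0 : 0 < q) (hq1 : q < 1) (ha : ‖a‖ < 1)
    (hb : ‖b‖ < 1) (hc : ‖c‖ < 1) (hd : ‖d‖ < 1) :
    ∫ θ in (0 : ℝ)..2 * Real.pi, askeyWilsonKernel q a b c d (circleMap 0 1 θ) *
      ((1 - a * b * c * d) * (circleMap 0 1 θ + (circleMap 0 1 θ)⁻¹) -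
        (a + b + c + d - (a * b * c + a * b * d + a * c * d + b * c * d))) = 0 := by
  have hqn : ‖(q : ℂ)‖ = q := by simp [abs_of_pos hq0]
  have hq : ‖(q : ℂ)‖ < 1 := by rwa [hqn]
  have hqz : (q : ℂ) ≠ 0 := by exact_mod_cast hq0.ne'
  have hG : ∀ z : ℂ, q ≤ ‖z‖ → ‖z‖ ≤ 1 →
      DifferentiableAt ℂ (askeyWilsonPrimitive q a b c d) z := fun z h1 h2 =>
    differentiableAt_askeyWilsonPrimitive hq hqz ha hb hc hd (by rwa [hqn]) h2
  have hcont : Continuous fun θ : ℝ => askeyWilsonPrimitive q a b c d (circleMap 0 1 θ) :=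
    continuous_iff_continuousAt.2 fun θ =>
      ContinuousAt.comp (g := askeyWilsonPrimitive q a b c d)
        (hG _ (by simpa using hq1.le) (by simp)).continuousAt
        (continuous_circleMap 0 1).continuousAt
  have hcont' : Continuous fun θ : ℝ => askeyWilsonPrimitive q a b c d (circleMap 0 1 θ)⁻¹ :=
    continuous_iff_continuousAt.2 fun θ =>
      ContinuousAt.comp (g := askeyWilsonPrimitive q a b c d)
        (hG _ (by simpa using hq1.le) (by simp)).continuousAt
        ((continuous_circleMap 0 1).continuousAt.inv₀ (circleMap_zero_one_ne_zero θ))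
  have h := integral_circleMap_eq_of_differentiableAt_annulus hq0 hq1.le hG
  have hr : ∀ θ : ℝ, askeyWilsonPrimitive q a b c d (circleMap 0 q θ) =
      -askeyWilsonPrimitive q a b c d (circleMap 0 1 θ)⁻¹ := fun θ => by
    rw [← askeyWilsonPrimitive_mul hq hqz a b c d (circleMap_zero_one_ne_zero θ)]
    simp [circleMap]
  simp only [hr, intervalIntegral.integral_neg] at h
  simp only [← askeyWilsonPrimitive_add_inv hq ha hb hc hd (norm_circleMap_zero_one _)]
  rw [intervalIntegral.integral_add (hcont.intervalIntegrable _ _)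
    (hcont'.intervalIntegrable _ _), h, neg_add_cancel]

/-- The shift multiplies the weight by `1 + a² - a(z + 1/z)`. The vanishing integral eliminates `z +
1/z`, and the remaining constant factors as `(1 - ab)(1 - ac)(1 - ad)`. -/
theorem askeyWilsonIntegral_mul_right {q : ℝ} (hq0 : 0 < q) (hq1 : q < 1) (ha : ‖a‖ < 1)
    (hb : ‖b‖ < 1) (hc : ‖c‖ < 1) (hd : ‖d‖ < 1) :
    (1 - a * b * c * d) * askeyWilsonIntegral q (a * q) b c d =
      (1 - a * b) * (1 - a * c) * (1 - a * d) * askeyWilsonIntegral q a b c d := by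
  have hq : ‖(q : ℂ)‖ < 1 := by simpa [abs_of_pos hq0]
  have h0 := integral_askeyWilsonKernel_mul_eq_zero hq0 hq1 ha hb hc hd
  have hK := continuous_askeyWilsonKernel_circleMap hq ha hb hc hd
  have hz : Continuous fun θ : ℝ => (circleMap 0 1 θ + (circleMap 0 1 θ)⁻¹) :=
    (continuous_circleMap 0 1).add ((continuous_circleMap 0 1).inv₀ circleMap_zero_one_ne_zero)
  have hpt : ∀ θ : ℝ, (1 - a * b * c * d) *
      askeyWilsonKernel q (a * q) b c d (circleMap 0 1 θ) =
      (1 - a * b) * (1 - a * c) * (1 - a * d) * askeyWilsonKernel q a b c d (circleMap 0 1 θ) -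
      a * (askeyWilsonKernel q a b c d (circleMap 0 1 θ) *
      ((1 - a * b * c * d) * (circleMap 0 1 θ + (circleMap 0 1 θ)⁻¹) -
        (a + b + c + d - (a * b * c + a * b * d + a * c * d + b * c * d)))) := fun θ => by
    rw [askeyWilsonKernel_mul_right hq ha b c d (norm_circleMap_zero_one θ)]
    have := mul_inv_cancel₀ (circleMap_zero_one_ne_zero θ)
    linear_combination (1 - a * b * c * d) * a ^ 2 *
      askeyWilsonKernel q a b c d (circleMap 0 1 θ) * this
  rw [askeyWilsonIntegral, askeyWilsonIntegral, ← intervalIntegral.integral_const_mul,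
    intervalIntegral.integral_congr fun θ _ => hpt θ, intervalIntegral.integral_sub,
    intervalIntegral.integral_const_mul, intervalIntegral.integral_const_mul, h0, mul_zero,
    sub_zero]
  · exact (hK.const_mul _).intervalIntegrable _ _
  · exact ((hK.mul ((hz.const_mul _).sub continuous_const)).const_mul a).intervalIntegrable _ _

/-- Cyclic symmetry carries the shift in the first parameter over to the other three. -/
theorem askeyWilsonIntegral_rotate (q a b c d : ℂ) :
    askeyWilsonIntegral q b c d a = askeyWilsonIntegral q a b c d := by
  refine intervalIntegral.integral_congr fun θ _ => ?_
  simp only [askeyWilsonKernel]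
  congr 1
  ring

/-- The Askey-Wilson integral divided by its closed form, up to a constant. -/
def askeyWilsonRatio (q a b c d : ℂ) : ℂ :=
  askeyWilsonIntegral q a b c d *
    (qPochInf q (a * b) * qPochInf q (a * c) * qPochInf q (a * d) * qPochInf q (b * c) *
      qPochInf q (b * d) * qPochInf q (c * d)) / qPochInf q (a * b * c * d)

theorem askeyWilsonRatio_rotate (q a b c d : ℂ) :
    askeyWilsonRatio q b c d a = askeyWilsonRatio q a b c d := by
  rw [askeyWilsonRatio, askeyWilsonRatio, askeyWilsonIntegral_rotate, mul_comm b a, mul_comm c a,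
    mul_comm d a, show b * c * d * a = a * b * c * d by ring]
  ring

theorem norm_mul_mul_mul_lt_one (ha : ‖a‖ < 1) (hb : ‖b‖ < 1) (hc : ‖c‖ < 1) (hd : ‖d‖ < 1) :
    ‖a * b * c * d‖ < 1 :=
  norm_mul_lt_one (norm_mul_lt_one (norm_mul_lt_one ha hb.le) hc.le) hd.le

theorem askeyWilsonRatio_mul_right {q : ℝ} (hq0 : 0 < q) (hq1 : q < 1) (ha : ‖a‖ < 1)
    (hb : ‖b‖ < 1) (hc : ‖c‖ < 1) (hd : ‖d‖ < 1) :
    askeyWilsonRatio q (a * q) b c d = askeyWilsonRatio q a b c d := by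
  have hq : ‖(q : ℂ)‖ < 1 := by simpa [abs_of_pos hq0]
  have h := askeyWilsonIntegral_mul_right hq0 hq1 ha hb hc hd
  have hp := norm_mul_mul_mul_lt_one ha hb hc hd
  have h1 : 1 - a * b * c * d ≠ 0 := one_sub_ne_zero_of_norm_lt hp
  have h2 : qPochInf q (a * b * c * d * q) ≠ 0 :=
    qPochInf_ne_zero_of_norm_lt hq (norm_mul_lt_one hp hq.le)
  rw [askeyWilsonRatio, askeyWilsonRatio, qPochInf_eq_one_sub_mul hq (a * b),
    qPochInf_eq_one_sub_mul hq (a * c), qPochInf_eq_one_sub_mul hq (a * d),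
    qPochInf_eq_one_sub_mul hq (a * b * c * d), mul_right_comm a (q : ℂ) b,
    mul_right_comm a (q : ℂ) c, mul_right_comm a (q : ℂ) d, mul_right_comm (a * b) (q : ℂ) c,
    mul_right_comm (a * b * c) (q : ℂ) d, div_eq_div_iff h2 (mul_ne_zero h1 h2)]
  linear_combination (qPochInf q (a * b * q) * qPochInf q (a * c * q) * qPochInf q (a * d * q) *
    qPochInf q (b * c) * qPochInf q (b * d) * qPochInf q (c * d) *
    qPochInf q (a * b * c * d * q)) * h

theorem askeyWilsonRatio_mul_right_all {q : ℝ} (hq0 : 0 < q) (hq1 : q < 1) (ha : ‖a‖ < 1)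
    (hb : ‖b‖ < 1) (hc : ‖c‖ < 1) (hd : ‖d‖ < 1) :
    askeyWilsonRatio q (a * q) (b * q) (c * q) (d * q) = askeyWilsonRatio q a b c d := by
  have hq : ‖(q : ℂ)‖ < 1 := by simpa [abs_of_pos hq0]
  have hm : ∀ {u : ℂ}, ‖u‖ < 1 → ‖u * q‖ < 1 := fun hu => norm_mul_lt_one hu hq.le
  rw [askeyWilsonRatio_mul_right hq0 hq1 ha (hm hb) (hm hc) (hm hd), ← askeyWilsonRatio_rotate,
    askeyWilsonRatio_mul_right hq0 hq1 hb (hm hc) (hm hd) ha, ← askeyWilsonRatio_rotate,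
    askeyWilsonRatio_mul_right hq0 hq1 hc (hm hd) ha hb, ← askeyWilsonRatio_rotate,
    askeyWilsonRatio_mul_right hq0 hq1 hd ha hb hc, ← askeyWilsonRatio_rotate]

/-- Scaling by `t` in the closed unit disc keeps all parameters inside the unit disc, and the disc
contains both the points `q ^ n` and their limit `0`. -/
theorem continuous_askeyWilsonRatio_smul (hq : ‖q‖ < 1) (ha : ‖a‖ < 1) (hb : ‖b‖ < 1)
    (hc : ‖c‖ < 1) (hd : ‖d‖ < 1) :
    Continuous fun t : Metric.closedBall (0 : ℂ) 1 =>
      askeyWilsonRatio q (a * t) (b * t) (c * t) (d * t) := by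
  have hP := continuous_qPochInf hq
  have hm : ∀ {u : ℂ}, ‖u‖ < 1 → ∀ t : Metric.closedBall (0 : ℂ) 1, ‖u * t‖ < 1 := fun hu t =>
    norm_mul_lt_one hu (mem_closedBall_zero_iff.1 t.2)
  have hI : Continuous fun t : Metric.closedBall (0 : ℂ) 1 =>
      askeyWilsonIntegral q (a * t) (b * t) (c * t) (d * t) := by
    refine intervalIntegral.continuous_parametric_intervalIntegral_of_continuous' ?_ _ _
    exact Continuous.askeyWilsonKernel hq (by fun_prop) (by fun_prop) (by fun_prop) (by fun_prop)
      ((continuous_circleMap 0 1).comp continuous_snd) (fun p => hm ha p.1) (fun p => hm hb p.1)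
      (fun p => hm hc p.1) (fun p => hm hd p.1) (fun p => norm_circleMap_zero_one _)
  refine Continuous.div (by fun_prop) (by fun_prop) fun t => ?_
  exact qPochInf_ne_zero_of_norm_lt hq
    (norm_mul_mul_mul_lt_one (hm ha t) (hm hb t) (hm hc t) (hm hd t))

theorem askeyWilsonRatio_eq_zero_parameters {q : ℝ} (hq0 : 0 < q) (hq1 : q < 1) (ha : ‖a‖ < 1)
    (hb : ‖b‖ < 1) (hc : ‖c‖ < 1) (hd : ‖d‖ < 1) :
    askeyWilsonRatio q a b c d = askeyWilsonRatio q 0 0 0 0 := by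
  have hq : ‖(q : ℂ)‖ < 1 := by simpa [abs_of_pos hq0]
  have hn : ∀ n : ℕ, ‖(q : ℂ) ^ n‖ ≤ 1 := fun n => by
    rw [norm_pow]
    exact pow_le_one₀ (norm_nonneg _) hq.le
  have hconst : ∀ n : ℕ, askeyWilsonRatio q (a * q ^ n) (b * q ^ n) (c * q ^ n) (d * q ^ n) =
      askeyWilsonRatio q a b c d := by
    intro n
    induction n with
    | zero => simp
    | succ n ih =>
      rw [← ih, ← askeyWilsonRatio_mul_right_all hq0 hq1 (norm_mul_lt_one ha (hn n))
        (norm_mul_lt_one hb (hn n)) (norm_mul_lt_one hc (hn n)) (norm_mul_lt_one hd (hn n))]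
      simp only [pow_succ, mul_assoc]
  have hlim : Tendsto (fun n : ℕ => (⟨(q : ℂ) ^ n, by simpa using hn n⟩ :
      Metric.closedBall (0 : ℂ) 1)) atTop (𝓝 ⟨0, by simp⟩) :=
    tendsto_subtype_rng.2 (tendsto_pow_atTop_nhds_zero_of_norm_lt_one hq)
  have := ((continuous_askeyWilsonRatio_smul hq ha hb hc hd).tendsto _).comp hlim
  simp only [Function.comp_def, hconst, mul_zero] at this
  exact tendsto_nhds_unique tendsto_const_nhds this

theorem integral_one_sub_sq_mul_one_sub_inv_sq :
    ∫ θ in (0 : ℝ)..2 * Real.pi,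
      (1 - circleMap 0 1 θ ^ 2) * (1 - (circleMap 0 1 θ)⁻¹ ^ 2) = (4 * Real.pi : ℂ) := by
  have h : ∀ θ : ℝ, (1 - circleMap 0 1 θ ^ 2) * (1 - (circleMap 0 1 θ)⁻¹ ^ 2) =
      2 - Complex.exp (2 * Complex.I * θ) - Complex.exp (-(2 * Complex.I) * θ) := fun θ => by
    have e1 : circleMap 0 1 θ ^ 2 = Complex.exp (2 * Complex.I * θ) := by
      rw [circleMap_zero, Complex.ofReal_one, one_mul, ← Complex.exp_nat_mul]
      congr 1
      push_cast
      ring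
    rw [inv_pow, e1, neg_mul, Complex.exp_neg]
    have := Complex.exp_ne_zero (2 * Complex.I * θ)
    field_simp
    ring
  have h2 : ∀ s : ℂ, s ≠ 0 → Complex.exp (s * (2 * Real.pi : ℝ)) = 1 →
      ∫ θ in (0 : ℝ)..2 * Real.pi, Complex.exp (s * θ) = 0 := fun s hs h => by
    rw [integral_exp_mul_complex hs, h]
    simp
  have hper : Complex.exp (2 * Complex.I * (2 * Real.pi : ℝ)) = 1 := by
    have := Complex.exp_int_mul_two_pi_mul_I 2
    rw [← this]
    congr 1
    push_cast
    ring
  simp only [h]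
  rw [intervalIntegral.integral_sub, intervalIntegral.integral_sub,
    h2 _ (by simp) hper, h2 _ (by simp) (by rw [neg_mul, Complex.exp_neg, hper, inv_one])]
  · simp
    ring
  all_goals exact Continuous.intervalIntegrable (by fun_prop) _ _

/-- For these parameters the Askey-Wilson weight is a Laurent polynomial. -/
theorem askeyWilsonKernel_special {p z : ℂ} (hp : ‖p‖ < 1) (hz : ‖z‖ = 1) :
    askeyWilsonKernel (p ^ 2) (p ^ 2) (-p ^ 2) p (-p) z = (1 - z ^ 2) * (1 - z⁻¹ ^ 2) := by
  have hq := norm_sq_lt_one hp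
  -- With base `q = p²`: the pair `±q` gives `(q²w²; q²)_∞`, the pair `±p` gives `(qw²; q²)_∞`, and
  -- these are the odd and even factors of `(qw²; q)_∞`.
  have key : ∀ w : ℂ, qPochInf (p ^ 2) (p ^ 2 * w) * qPochInf (p ^ 2) (-p ^ 2 * w) *
      (qPochInf (p ^ 2) (p * w) * qPochInf (p ^ 2) (-p * w)) =
      qPochInf (p ^ 2) (p ^ 2 * w ^ 2) := fun w => by
    rw [neg_mul, neg_mul, qPochInf_mul_neg hq, qPochInf_mul_neg hq,
      ← qPochInf_sq_mul hq (p ^ 2 * w ^ 2), mul_comm]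
    ring_nf
  have hne : ∀ w : ℂ, ‖w‖ = 1 → qPochInf (p ^ 2) (p ^ 2 * w ^ 2) ≠ 0 := fun w hw =>
    qPochInf_ne_zero_of_norm_lt hq (norm_mul_lt_one hq (by simp [hw]))
  have hs : ∀ w : ℂ, qPochInf (p ^ 2) (w ^ 2) = (1 - w ^ 2) * qPochInf (p ^ 2) (p ^ 2 * w ^ 2) :=
    fun w => by rw [qPochInf_eq_one_sub_mul hq, mul_comm (p ^ 2)]
  have hden : askeyWilsonFactor (p ^ 2) (p ^ 2) z * askeyWilsonFactor (p ^ 2) (-p ^ 2) z *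
      askeyWilsonFactor (p ^ 2) p z * askeyWilsonFactor (p ^ 2) (-p) z =
      qPochInf (p ^ 2) (p ^ 2 * z ^ 2) * qPochInf (p ^ 2) (p ^ 2 * z⁻¹ ^ 2) := by
    rw [← key z, ← key z⁻¹]
    simp only [askeyWilsonFactor]
    ring
  have h1 := hne z hz
  have h2 := hne z⁻¹ (by simp [hz])
  rw [askeyWilsonKernel, hden, hs z, hs z⁻¹, div_eq_iff (mul_ne_zero h1 h2)]
  ring

/-- The weight integrates to `4π`; the remaining products collapse by Euler's identity `(q; q²)_∞
(-q; q)_∞ = 1`. -/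
theorem askeyWilsonRatio_special {p : ℂ} (hp : ‖p‖ < 1) :
    askeyWilsonRatio (p ^ 2) (p ^ 2) (-p ^ 2) p (-p) = 4 * Real.pi / qPochInf (p ^ 2) (p ^ 2) := by
  have hq := norm_sq_lt_one hp
  have hI : askeyWilsonIntegral (p ^ 2) (p ^ 2) (-p ^ 2) p (-p) = 4 * Real.pi := by
    simp only [askeyWilsonIntegral, askeyWilsonKernel_special hp (norm_circleMap_zero_one _)]
    exact integral_one_sub_sq_mul_one_sub_inv_sq
  have hpow : ∀ n : ℕ, n ≠ 0 → ‖p ^ n‖ < 1 := fun n hn => by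
    rw [norm_pow]
    exact pow_lt_one₀ (norm_nonneg _) hp hn
  set q := p ^ 2 with hqdef
  have hR : qPochInf q (q ^ 3) ≠ 0 := qPochInf_ne_zero_of_norm_lt hq (by
    rw [hqdef, ← pow_mul]; exact hpow _ (by norm_num))
  have hQ : qPochInf q q ≠ 0 := qPochInf_ne_zero_of_norm_lt hq hq
  have hE : qPochInf (q ^ 2) (q ^ 2) ≠ 0 :=
    qPochInf_ne_zero_of_norm_lt (norm_sq_lt_one hq) (norm_sq_lt_one hq)
  have e1 : qPochInf q (q * p) * qPochInf q (-(q * p)) = qPochInf (q ^ 2) (q ^ 3) := by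
    rw [qPochInf_mul_neg hq]
    congr 1
    rw [hqdef]; ring
  have e2 : qPochInf (q ^ 2) q * qPochInf (q ^ 2) (q ^ 2) = qPochInf q q := by
    rw [← qPochInf_sq_mul hq q, ← pow_two]
  have e3 : qPochInf q q * qPochInf q (-q) = qPochInf (q ^ 2) (q ^ 2) := qPochInf_mul_neg hq q
  have e4 : qPochInf q (-q) = (1 + q) * qPochInf q (-q ^ 2) := by
    rw [qPochInf_eq_one_sub_mul hq]
    ring_nf
  have e5 : qPochInf (q ^ 2) q = (1 - q) * qPochInf (q ^ 2) (q ^ 3) := by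
    rw [qPochInf_eq_one_sub_mul (norm_sq_lt_one hq)]
    ring_nf
  have e6 : qPochInf q q = (1 - q) * ((1 - q ^ 2) * qPochInf q (q ^ 3)) := by
    rw [qPochInf_eq_one_sub_mul hq, qPochInf_eq_one_sub_mul hq (q * q)]
    ring_nf
  -- Euler's identity with the first factor of each product split off.
  have e7 : qPochInf q (-q ^ 2) * qPochInf (q ^ 2) (q ^ 3) * (1 - q ^ 2) = 1 := by
    have : qPochInf (q ^ 2) q * qPochInf q (-q) = 1 := by
      apply mul_left_cancel₀ hE
      linear_combination qPochInf q (-q) * e2 + e3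
    rw [e4, e5] at this
    linear_combination this
  rw [askeyWilsonRatio, hI,
    show q * -q = -q ^ 2 by ring, show q * -p = -(q * p) by ring, show -q * p = -(q * p) by ring,
    show -q * -p = q * p by ring, show p * -p = -q by rw [hqdef]; ring,
    show -q ^ 2 * p * -p = q ^ 3 by rw [hqdef]; ring,
    div_eq_div_iff hR hQ, mul_assoc]
  congr 1
  calc _ = qPochInf q (-q ^ 2) * (qPochInf q (q * p) * qPochInf q (-(q * p))) ^ 2 *
        qPochInf q (-q) * qPochInf q q := by ring
    _ = (qPochInf q (-q ^ 2) * qPochInf (q ^ 2) (q ^ 3) * (1 - q ^ 2)) ^ 2 *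
        qPochInf q (q ^ 3) := by
      rw [e1, e4, e6]
      ring
    _ = _ := by rw [e7]; ring

/-- The Askey-Wilson integral over the whole circle. -/
theorem askeyWilsonIntegral_eq {q : ℝ} (hq0 : 0 < q) (hq1 : q < 1) (ha : ‖a‖ < 1)
    (hb : ‖b‖ < 1) (hc : ‖c‖ < 1) (hd : ‖d‖ < 1) :
    askeyWilsonIntegral q a b c d = 4 * Real.pi * qPochInf q (a * b * c * d) /
      (qPochInf q q * qPochInf q (a * b) * qPochInf q (a * c) * qPochInf q (a * d) *
        qPochInf q (b * c) * qPochInf q (b * d) * qPochInf q (c * d)) := by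
  have hq : ‖(q : ℂ)‖ < 1 := by simpa [abs_of_pos hq0]
  have hp1 : ‖((√q : ℝ) : ℂ)‖ < 1 := by
    rw [Complex.norm_real, Real.norm_of_nonneg (Real.sqrt_nonneg q), Real.sqrt_lt' one_pos]
    simpa using hq1
  have hp2 : ((√q : ℝ) : ℂ) ^ 2 = q := by exact_mod_cast Real.sq_sqrt hq0.le
  have h := askeyWilsonRatio_special hp1
  -- Constancy is used twice: from the special parameters to zero, then from zero to `a, b, c, d`.
  rw [hp2, askeyWilsonRatio_eq_zero_parameters hq0 hq1 hq (by simpa using hq) hp1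
    (by simpa using hp1), ← askeyWilsonRatio_eq_zero_parameters hq0 hq1 ha hb hc hd,
    askeyWilsonRatio] at h
  have hne : ∀ {u v : ℂ}, ‖u‖ < 1 → ‖v‖ < 1 → qPochInf q (u * v) ≠ 0 := fun hu hv =>
    qPochInf_ne_zero_of_norm_lt hq (norm_mul_lt_one hu hv.le)
  have h0 := qPochInf_ne_zero_of_norm_lt hq hq
  have h1 := hne ha hb
  have h2 := hne ha hc
  have h3 := hne ha hd
  have h4 := hne hb hc
  have h5 := hne hb hd
  have h6 := hne hc hd
  have h7 := qPochInf_ne_zero_of_norm_lt hq (norm_mul_mul_mul_lt_one ha hb hc hd)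
  field_simp at h ⊢
  linear_combination h

theorem askeyWilsonKernel_inv (q a b c d z : ℂ) :
    askeyWilsonKernel q a b c d z⁻¹ = askeyWilsonKernel q a b c d z := by
  simp only [askeyWilsonKernel, askeyWilsonFactor, inv_inv]
  ring_nf

/-- The Askey-Wilson integral. -/
theorem integral_askeyWilsonKernel {q : ℝ} (hq0 : 0 < q) (hq1 : q < 1) (ha : ‖a‖ < 1)
    (hb : ‖b‖ < 1) (hc : ‖c‖ < 1) (hd : ‖d‖ < 1) :
    ∫ θ in (0 : ℝ)..Real.pi, askeyWilsonKernel q a b c d (circleMap 0 1 θ) =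
      2 * Real.pi * qPochInf q (a * b * c * d) /
      (qPochInf q q * qPochInf q (a * b) * qPochInf q (a * c) * qPochInf q (a * d) *
        qPochInf q (b * c) * qPochInf q (b * d) * qPochInf q (c * d)) := by
  have hq : ‖(q : ℂ)‖ < 1 := by simpa [abs_of_pos hq0]
  have hK := continuous_askeyWilsonKernel_circleMap hq ha hb hc hd
  have h := askeyWilsonIntegral_eq hq0 hq1 ha hb hc hd
  -- The reflection `θ ↦ 2π - θ` is `z ↦ 1/z`, so each half of the circle contributes equally.
  have hsym : ∀ θ : ℝ, askeyWilsonKernel q a b c d (circleMap 0 1 (2 * Real.pi - θ)) =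
      askeyWilsonKernel q a b c d (circleMap 0 1 θ) := fun θ => by
    rw [← askeyWilsonKernel_inv]
    congr 1
    rw [circleMap_zero, circleMap_zero, Complex.ofReal_one, one_mul, one_mul, ← Complex.exp_neg,
      Complex.exp_eq_exp_iff_exists_int]
    exact ⟨-1, by push_cast; ring⟩
  have hhalf : ∫ θ in Real.pi..2 * Real.pi, askeyWilsonKernel q a b c d (circleMap 0 1 θ) =
      ∫ θ in (0 : ℝ)..Real.pi, askeyWilsonKernel q a b c d (circleMap 0 1 θ) := by
    have := intervalIntegral.integral_comp_sub_left (a := 0) (b := Real.pi)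
      (fun θ => askeyWilsonKernel q a b c d (circleMap 0 1 θ)) (2 * Real.pi)
    simp only [hsym] at this
    rw [this]
    congr 1 <;> ring
  rw [askeyWilsonIntegral, ← intervalIntegral.integral_add_adjacent_intervals
    (hK.intervalIntegrable 0 Real.pi) (hK.intervalIntegrable _ _), hhalf] at h
  linear_combination h / 2

end AskeyWilsonEvaluation

/-! ### The terminating series: decay in `k` and orthogonality. -/

noncomputable section TerminatingSeries

open Filter Topology

theorem zpow_neg_mul_pow_self {q : ℂ} (k : ℕ) (hq0 : q ≠ 0) :
    q ^ (-(k : ℤ)) * q ^ k = 1 := by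
  rw [zpow_neg, zpow_natCast, inv_mul_cancel₀ (pow_ne_zero _ hq0)]

theorem qPoch_zpow_neg_eq_zero {q : ℂ} (hq0 : q ≠ 0) {k n : ℕ} (h : k < n) :
    qPoch q (q ^ (-(k : ℤ))) n = 0 :=
  Finset.prod_eq_zero (Finset.mem_range.2 h) (by rw [zpow_neg_mul_pow_self k hq0, sub_self])

/-- The coefficient `(q^{-k};q)_n / (q;q)_n` of a terminating basic hypergeometric series. -/
def qBinomCoeff (q : ℂ) (k n : ℕ) : ℂ := qPoch q (q ^ (-(k : ℤ))) n / qPoch q q n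

/-- A `q`-Pascal rule: on generating functions it is multiplication by `1 - z q^{-(k+1)}`. -/
theorem qBinomCoeff_succ {q : ℂ} (hq : ‖q‖ < 1) (hq0 : q ≠ 0) (k n : ℕ) :
    qBinomCoeff q (k + 1) (n + 1) =
      qBinomCoeff q k (n + 1) - q ^ (-((k + 1 : ℕ) : ℤ)) * qBinomCoeff q k n := by
  have h1 : q ^ (-((k + 1 : ℕ) : ℤ)) * q = q ^ (-(k : ℤ)) := by
    rw [← zpow_add_one₀ hq0]
    congr 1
    push_cast
    ring
  have h2 : qPoch q q n ≠ 0 := qPoch_ne_zero_of_norm_lt hq hq n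
  have h3 : 1 - q * q ^ n ≠ 0 := sub_ne_zero.2 (mul_pow_ne_one_of_norm_lt hq hq n).symm
  rw [qBinomCoeff, qBinomCoeff, qBinomCoeff, qPoch_succ', h1, qPoch_succ q (q ^ (-(k : ℤ))),
    qPoch_succ q q, ← h1]
  field_simp
  ring

/-- The terminating case of the `q`-binomial theorem. -/
theorem sum_qBinomCoeff_mul_pow {q : ℂ} (hq : ‖q‖ < 1) (hq0 : q ≠ 0) (k : ℕ) (z : ℂ) :
    ∑ n ∈ Finset.range (k + 1), qBinomCoeff q k n * z ^ n =
      ∏ j ∈ Finset.range k, (1 - z * q ^ (-((j + 1 : ℕ) : ℤ))) := by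
  induction k with
  | zero => simp [qBinomCoeff]
  | succ k ih =>
    have h0 : ∀ k, qBinomCoeff q k 0 = 1 := fun k => by simp [qBinomCoeff]
    have hk : qBinomCoeff q k (k + 1) = 0 := by
      rw [qBinomCoeff, qPoch_zpow_neg_eq_zero hq0 k.lt_succ_self, zero_div]
    have h1 : ∑ n ∈ Finset.range (k + 1), qBinomCoeff q k (n + 1) * z ^ (n + 1) + 1 =
        ∑ n ∈ Finset.range (k + 1), qBinomCoeff q k n * z ^ n := by
      have h := Finset.sum_range_succ' (fun n => qBinomCoeff q k n * z ^ n) (k + 1)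
      rw [Finset.sum_range_succ, hk, zero_mul, add_zero, h0, pow_zero, mul_one] at h
      exact h.symm
    rw [Finset.prod_range_succ, ← ih, Finset.sum_range_succ', h0, pow_zero, mul_one]
    simp only [qBinomCoeff_succ hq hq0, sub_mul, Finset.sum_sub_distrib]
    rw [mul_sub, mul_one, ← h1]
    have h2 : ∑ n ∈ Finset.range (k + 1), q ^ (-((k + 1 : ℕ) : ℤ)) * qBinomCoeff q k n * z ^ (n + 1)
        = (∑ n ∈ Finset.range (k + 1), qBinomCoeff q k n * z ^ n) *
          (z * q ^ (-((k + 1 : ℕ) : ℤ))) := by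
      rw [Finset.sum_mul]
      exact Finset.sum_congr rfl fun n _ => by ring
    rw [h2, ← h1]
    ring

/-- The point `q ^ (m + 1)` is a root of the product, namely of its factor `j = m`. It is the
`q`-analogue of a `k`-th difference killing powers of degree `m < k`; the extra `q` is the argument
of the `₄φ₃`. -/
theorem sum_qBinomCoeff_mul_pow_eq_zero {q : ℂ} (hq : ‖q‖ < 1) (hq0 : q ≠ 0) {k m : ℕ}
    (h : m < k) :
    ∑ n ∈ Finset.range (k + 1), qBinomCoeff q k n * (q ^ (m + 1)) ^ n = 0 := by
  rw [sum_qBinomCoeff_mul_pow hq hq0]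
  refine Finset.prod_eq_zero (Finset.mem_range.2 h) ?_
  rw [mul_comm, zpow_neg_mul_pow_self _ hq0, sub_self]

/-- Every factor of the product is `1 - q^{m-j}` with `m - j ≥ 1`, hence lies in `[0, 1]`. -/
theorem norm_sum_qBinomCoeff_mul_pow_le {q : ℝ} (hq0 : 0 < q) (hq1 : q < 1) {k m : ℕ}
    (h : k ≤ m) :
    ‖∑ n ∈ Finset.range (k + 1), qBinomCoeff q k n * ((q : ℂ) ^ (m + 1)) ^ n‖ ≤ 1 := by
  have hq : ‖(q : ℂ)‖ < 1 := by simpa [abs_of_pos hq0]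
  have hqz : (q : ℂ) ≠ 0 := by exact_mod_cast hq0.ne'
  rw [sum_qBinomCoeff_mul_pow hq hqz, norm_prod]
  refine Finset.prod_le_one (fun _ _ => norm_nonneg _) fun j hj => ?_
  have hj' : j < k := Finset.mem_range.1 hj
  have e : (q : ℂ) ^ (m + 1) * (q : ℂ) ^ (-((j + 1 : ℕ) : ℤ)) = ((q ^ (m - j) : ℝ) : ℂ) := by
    rw [show m + 1 = (m - j) + (j + 1) by omega, pow_add, mul_assoc, mul_comm (_ ^ (j + 1)),
      zpow_neg_mul_pow_self _ hqz, mul_one]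
    push_cast
    rfl
  rw [e, ← Complex.ofReal_one, ← Complex.ofReal_sub, Complex.norm_real,
    Real.norm_of_nonneg (sub_nonneg.2 (pow_le_one₀ hq0.le hq1.le))]
  linarith [pow_pos hq0 (m - j)]

/-- Iterated `q`-differences of an analytic function decay geometrically. -/
theorem norm_sum_qBinomCoeff_mul_le {q : ℝ} (hq0 : 0 < q) (hq1 : q < 1) {F : ℂ → ℂ} {ρ M : ℝ}
    {a : ℂ} (hF : DiffContOnCl ℂ F (Metric.ball 0 ρ)) (hM : ∀ t : ℂ, ‖t‖ = ρ → ‖F t‖ ≤ M)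
    (ha : ‖a‖ < ρ) (k : ℕ) :
    ‖∑ n ∈ Finset.range (k + 1), qBinomCoeff q k n * (q : ℂ) ^ n * F (a * q ^ n)‖ ≤
      M * (1 - ‖a‖ / ρ)⁻¹ * (‖a‖ / ρ) ^ k := by
  have hq : ‖(q : ℂ)‖ < 1 := by simpa [abs_of_pos hq0]
  have hqz : (q : ℂ) ≠ 0 := by exact_mod_cast hq0.ne'
  have hρ : 0 < ρ := (norm_nonneg a).trans_lt ha
  set r := ‖a‖ / ρ with hr
  have hr0 : 0 ≤ r := by positivity
  have hr1 : r < 1 := (div_lt_one hρ).2 ha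
  set f : ℕ → ℂ := fun m => (m.factorial : ℂ)⁻¹ * iteratedDeriv m F 0 with hf
  -- Cauchy's estimates for the Taylor coefficients.
  have hfM : ∀ m, ‖f m‖ ≤ M / ρ ^ m := fun m => by
    have := Complex.norm_iteratedDeriv_le_of_forall_mem_sphere_norm_le m hρ hF
      (fun z hz => hM z (by simpa using hz))
    rw [hf, norm_mul, norm_inv, Complex.norm_natCast, inv_mul_le_iff₀ (by positivity)]
    exact this.trans_eq (mul_div_assoc _ _ _)
  have hsum : ∀ t : ℂ, ‖t‖ < ρ → HasSum (fun m => f m * t ^ m) (F t) := fun t ht => by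
    have := Complex.hasSum_taylorSeries_on_ball hF.differentiableOn (z := t) (by simpa using ht)
    refine this.congr_fun fun m => ?_
    simp only [hf, smul_eq_mul, sub_zero]
    ring
  have haq : ∀ n : ℕ, ‖a * (q : ℂ) ^ n‖ < ρ := fun n => by
    rw [norm_mul, norm_pow]
    exact (mul_le_of_le_one_right (norm_nonneg _)
      (pow_le_one₀ (norm_nonneg _) hq.le)).trans_lt ha
  have hS : HasSum (fun m => f m * a ^ m *
      ∑ n ∈ Finset.range (k + 1), qBinomCoeff q k n * ((q : ℂ) ^ (m + 1)) ^ n)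
      (∑ n ∈ Finset.range (k + 1), qBinomCoeff q k n * (q : ℂ) ^ n * F (a * q ^ n)) := by
    refine (hasSum_sum fun n _ => (hsum _ (haq n)).mul_left
      (qBinomCoeff q k n * (q : ℂ) ^ n)).congr_fun fun m => ?_
    rw [Finset.mul_sum]
    exact Finset.sum_congr rfl fun n _ => by ring
  -- The `q`-difference kills the Taylor terms with `m < k` and does not enlarge the others, so a
  -- geometric tail starting at `k` is the majorant.
  have hg : HasSum (fun m => if m < k then 0 else M * r ^ m) (M * (1 - r)⁻¹ * r ^ k) := by
    rw [← hasSum_nat_add_iff' k, Finset.sum_eq_zero fun i hi => if_pos (Finset.mem_range.1 hi),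
      sub_zero]
    have := (hasSum_geometric_of_lt_one hr0 hr1).mul_left (M * r ^ k)
    rw [mul_right_comm] at this
    refine this.congr_fun fun m => ?_
    rw [if_neg (by omega), pow_add]
    ring
  rw [← hS.tsum_eq]
  refine tsum_of_norm_bounded hg fun m => ?_
  split_ifs with h
  · rw [sum_qBinomCoeff_mul_pow_eq_zero hq hqz h, mul_zero, norm_zero]
  · rw [norm_mul, norm_mul, norm_pow]
    refine (mul_le_of_le_one_right (by positivity)
      (norm_sum_qBinomCoeff_mul_pow_le hq0 hq1 (not_lt.1 h))).trans ?_
    refine (mul_le_mul_of_nonneg_right (hfM m) (by positivity)).trans_eq ?_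
    rw [hr, div_pow]
    ring

/-- The terminating series `₄φ₃(q^{-k}, abcd, az, a/z; ab, ac, ad; q, q)` as a finite sum. -/
def terminatingPhi (q a b c d : ℂ) (k : ℕ) (z : ℂ) : ℂ :=
  ∑ n ∈ Finset.range (k + 1), qBinomCoeff q k n * q ^ n *
    (qPoch q (a * b * c * d) n * qPoch q (a * z) n * qPoch q (a * z⁻¹) n /
      (qPoch q (a * b) n * qPoch q (a * c) n * qPoch q (a * d) n))

theorem basicHypergeometric_eq_terminatingPhi {q : ℂ} (hq0 : q ≠ 0) (a b c d : ℂ) (k : ℕ) (z : ℂ) :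
    basicHypergeometric [q ^ (-(k : ℤ)), a * b * c * d, a * z, a * z⁻¹] [a * b, a * c, a * d] q q =
      terminatingPhi q a b c d k z := by
  rw [basicHypergeometric, tsum_eq_sum (s := Finset.range (k + 1)), terminatingPhi]
  · refine Finset.sum_congr rfl fun n _ => ?_
    simp only [qPochList, qBinomCoeff, List.map_cons, List.map_nil, List.prod_cons, List.prod_nil,
      List.length_cons, List.length_nil, mul_one]
    -- The sign factor has exponent `1 + 3 - 4 = 0`.
    norm_num
    rw [mul_div_mul_comm]
    ring_nf
  · intro n hn
    rw [Finset.mem_range, not_lt] at hn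
    rw [qPochList, List.map_cons, List.prod_cons,
      qPoch_zpow_neg_eq_zero hq0 (Nat.lt_of_succ_le hn), zero_mul, zero_div, zero_mul, zero_mul]

theorem continuous_terminatingPhi_circleMap (q a b c d : ℂ) (k : ℕ) :
    Continuous fun θ : ℝ => terminatingPhi q a b c d k (circleMap 0 1 θ) := by
  have hz := continuous_circleMap 0 1
  have hi := hz.inv₀ circleMap_zero_one_ne_zero
  refine continuous_finsetSum _ fun n _ => (Continuous.div_const ?_ _).const_mul _
  exact (((continuous_qPoch q n).comp (hz.const_mul a)).const_mul _).mul
    ((continuous_qPoch q n).comp (hi.const_mul a))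

/-- The function whose iterated `q`-differences are the terminating series. -/
def phiGenerating (q b c d z t : ℂ) : ℂ :=
  qPochInf q (t * b) * qPochInf q (t * c) * qPochInf q (t * d) /
    (qPochInf q (t * (b * c * d)) * qPochInf q (t * z) * qPochInf q (t * z⁻¹))

/-- Since `(u;q)_n = (u;q)_∞ / (uq^n;q)_∞`, the `n`-th summand depends on `n` through `F(aq^n) /
F(a)`, where `F` is `phiGenerating`. -/
theorem terminatingPhi_eq {q a b c d : ℂ} (hq : ‖q‖ < 1) (ha : ‖a‖ < 1) (hb : ‖b‖ < 1)
    (hc : ‖c‖ < 1) (hd : ‖d‖ < 1) (k : ℕ) {z : ℂ} (hz : ‖z‖ = 1) :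
    terminatingPhi q a b c d k z =
      (phiGenerating q b c d z a)⁻¹ * ∑ n ∈ Finset.range (k + 1),
        qBinomCoeff q k n * q ^ n * phiGenerating q b c d z (a * q ^ n) := by
  rw [terminatingPhi, Finset.mul_sum]
  refine Finset.sum_congr rfl fun n _ => ?_
  rw [mul_left_comm]
  congr 1
  have key : ∀ u : ℂ, ‖u‖ ≤ 1 → qPochInf q (a * u) = qPoch q (a * u) n * qPochInf q (a * q ^ n * u) ∧
      qPoch q (a * u) n ≠ 0 ∧ qPochInf q (a * q ^ n * u) ≠ 0 := fun u hu => by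
    have h1 := qPochInf_eq_qPoch_mul hq (a * u) n
    rw [mul_right_comm] at h1
    have h2 := qPochInf_ne_zero_of_norm_lt hq (norm_mul_lt_one ha hu)
    rw [h1] at h2
    exact ⟨h1, left_ne_zero_of_mul h2, right_ne_zero_of_mul h2⟩
  obtain ⟨b1, b2, b3⟩ := key b hb.le
  obtain ⟨c1, c2, c3⟩ := key c hc.le
  obtain ⟨d1, d2, d3⟩ := key d hd.le
  obtain ⟨e1, e2, e3⟩ := key (b * c * d) (norm_mul_lt_one (norm_mul_lt_one hb hc.le) hd.le).le
  obtain ⟨z1, z2, z3⟩ := key z hz.le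
  obtain ⟨w1, w2, w3⟩ := key z⁻¹ (by simp [hz])
  simp only [phiGenerating, b1, c1, d1, e1, z1, w1, show a * b * c * d = a * (b * c * d) by ring]
  generalize qPochInf q (a * q ^ n * b) = B at *
  generalize qPochInf q (a * q ^ n * c) = C at *
  generalize qPochInf q (a * q ^ n * d) = D at *
  generalize qPochInf q (a * q ^ n * (b * c * d)) = E at *
  generalize qPochInf q (a * q ^ n * z) = Z at *
  generalize qPochInf q (a * q ^ n * z⁻¹) = W at *
  generalize qPoch q (a * b) n = B' at *
  generalize qPoch q (a * c) n = C' at *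
  generalize qPoch q (a * d) n = D' at *
  generalize qPoch q (a * (b * c * d)) n = E' at *
  generalize qPoch q (a * z) n = Z' at *
  generalize qPoch q (a * z⁻¹) n = W' at *
  field_simp

/-- For `|t| ≤ ρ < 1` the generating function and its inverse are bounded uniformly in `|z| = 1`, so
the `q`-difference estimate applies with one constant. -/
theorem exists_norm_terminatingPhi_le {q : ℝ} (hq0 : 0 < q) (hq1 : q < 1) {a b c d : ℂ}
    (hb : ‖b‖ < 1) (hc : ‖c‖ < 1) (hd : ‖d‖ < 1) {ρ : ℝ} (ha : ‖a‖ < ρ) (hρ : ρ < 1) :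
    ∃ C, ∀ k : ℕ, ∀ z : ℂ, ‖z‖ = 1 → ‖terminatingPhi q a b c d k z‖ ≤ C * (‖a‖ / ρ) ^ k := by
  have hq : ‖(q : ℂ)‖ < 1 := by simpa [abs_of_pos hq0]
  have hρ0 : 0 < ρ := (norm_nonneg a).trans_lt ha
  obtain ⟨C₁, hC₁, h₁⟩ := exists_norm_qPochInf_le hq 1
  obtain ⟨C₂, hC₂, h₂⟩ := exists_norm_inv_qPochInf_le hq hρ
  have hm : ∀ {t u : ℂ}, ‖t‖ ≤ ρ → ‖u‖ ≤ 1 → ‖t * u‖ ≤ ρ := fun ht hu => by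
    rw [norm_mul]
    exact (mul_le_of_le_one_right (norm_nonneg _) hu).trans ht
  have hbcd : ‖b * c * d‖ ≤ 1 := (norm_mul_lt_one (norm_mul_lt_one hb hc.le) hd.le).le
  have hbound : ∀ {t z : ℂ}, ‖t‖ ≤ ρ → ‖z‖ = 1 →
      ‖phiGenerating q b c d z t‖ ≤ C₁ * C₁ * C₁ * (C₂ * C₂ * C₂) ∧
      ‖(phiGenerating q b c d z t)⁻¹‖ ≤ C₁ * C₁ * C₁ * (C₂ * C₂ * C₂) := by
    intro t z ht hz
    have hz' : ‖z⁻¹‖ ≤ 1 := by simp [hz]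
    have g1 : ∀ {u : ℂ}, ‖u‖ ≤ 1 → ‖qPochInf q (t * u)‖ ≤ C₁ := fun hu =>
      h₁ _ ((hm ht hu).trans hρ.le)
    have g2 : ∀ {u : ℂ}, ‖u‖ ≤ 1 → ‖qPochInf q (t * u)‖⁻¹ ≤ C₂ := fun hu => by
      rw [← norm_inv]
      exact h₂ _ (hm ht hu)
    rw [norm_inv, phiGenerating, norm_div, norm_mul, norm_mul, norm_mul, norm_mul, inv_div,
      div_eq_mul_inv, div_eq_mul_inv, mul_inv, mul_inv, mul_inv, mul_inv]
    constructor
    · gcongr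
      exacts [g1 hb.le, g1 hc.le, g1 hd.le, g2 hbcd, g2 hz.le, g2 hz']
    · gcongr
      exacts [g1 hbcd, g1 hz.le, g1 hz', g2 hb.le, g2 hc.le, g2 hd.le]
  set M := C₁ * C₁ * C₁ * (C₂ * C₂ * C₂) with hM
  refine ⟨M * (M * (1 - ‖a‖ / ρ)⁻¹), fun k z hz => ?_⟩
  have hdiff : DiffContOnCl ℂ (phiGenerating q b c d z) (Metric.ball 0 ρ) := by
    apply DifferentiableOn.diffContOnCl
    rw [closure_ball _ hρ0.ne']
    intro t ht
    have ht' : ‖t‖ < 1 := (mem_closedBall_zero_iff.1 ht).trans_lt hρ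
    have hD := differentiable_qPochInf hq
    have hp : ∀ u : ℂ, DifferentiableAt ℂ (fun t => qPochInf q (t * u)) t := fun u =>
      (hD _).comp t (differentiableAt_id.mul_const u)
    have hn : ∀ u : ℂ, ‖u‖ ≤ 1 → qPochInf q (t * u) ≠ 0 := fun u hu =>
      qPochInf_ne_zero_of_norm_lt hq (norm_mul_lt_one ht' hu)
    exact (DifferentiableAt.div (((hp b).mul (hp c)).mul (hp d)) (((hp _).mul (hp z)).mul (hp _))
      (mul_ne_zero (mul_ne_zero (hn _ hbcd) (hn z hz.le))
        (hn _ (by simp [hz])))).differentiableWithinAt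
  rw [terminatingPhi_eq hq (ha.trans hρ) hb hc hd k hz, norm_mul, mul_assoc]
  exact mul_le_mul (hbound ha.le hz).2
    (norm_sum_qBinomCoeff_mul_le hq0 hq1 hdiff (fun t ht => (hbound ht.le hz).1) ha k)
    (norm_nonneg _) (by positivity)

theorem askeyWilsonKernel_mul_pow {q a : ℂ} (hq : ‖q‖ < 1) (ha : ‖a‖ < 1) (b c d : ℂ) {z : ℂ}
    (hz : ‖z‖ = 1) (n : ℕ) :
    askeyWilsonKernel q (a * q ^ n) b c d z =
      qPoch q (a * z) n * qPoch q (a * z⁻¹) n * askeyWilsonKernel q a b c d z := by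
  induction n with
  | zero => simp
  | succ n ih =>
    have hn : ‖a * q ^ n‖ < 1 := norm_mul_lt_one ha (by
      rw [norm_pow]; exact pow_le_one₀ (norm_nonneg _) hq.le)
    rw [pow_succ, ← mul_assoc, askeyWilsonKernel_mul_right hq hn b c d hz, ih, qPoch_succ,
      qPoch_succ]
    ring

/-- The terminating series of positive degree are orthogonal to the constants. -/
theorem integral_askeyWilsonKernel_mul_terminatingPhi {q : ℝ} (hq0 : 0 < q) (hq1 : q < 1)
    {a b c d : ℂ} (ha : ‖a‖ < 1) (hb : ‖b‖ < 1) (hc : ‖c‖ < 1) (hd : ‖d‖ < 1) (k : ℕ) :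
    ∫ θ in (0 : ℝ)..Real.pi, askeyWilsonKernel q a b c d (circleMap 0 1 θ) *
      terminatingPhi q a b c d k (circleMap 0 1 θ) =
      if k = 0 then ∫ θ in (0 : ℝ)..Real.pi, askeyWilsonKernel q a b c d (circleMap 0 1 θ)
      else 0 := by
  have hq : ‖(q : ℂ)‖ < 1 := by simpa [abs_of_pos hq0]
  have hqz : (q : ℂ) ≠ 0 := by exact_mod_cast hq0.ne'
  have hn : ∀ n : ℕ, ‖a * (q : ℂ) ^ n‖ < 1 := fun n => norm_mul_lt_one ha (by
      rw [norm_pow]; exact pow_le_one₀ (norm_nonneg _) hq.le)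
  -- The factors `(az, a/z; q)_n` are absorbed by shifting `a` to `aq^n` in the weight.
  have hpt : ∀ θ : ℝ, askeyWilsonKernel q a b c d (circleMap 0 1 θ) *
      terminatingPhi q a b c d k (circleMap 0 1 θ) =
      ∑ n ∈ Finset.range (k + 1), qBinomCoeff q k n * (q : ℂ) ^ n *
        (qPoch q (a * b * c * d) n /
          (qPoch q (a * b) n * qPoch q (a * c) n * qPoch q (a * d) n)) *
        askeyWilsonKernel q (a * q ^ n) b c d (circleMap 0 1 θ) := fun θ => by
    rw [terminatingPhi, Finset.mul_sum]
    refine Finset.sum_congr rfl fun n _ => ?_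
    rw [askeyWilsonKernel_mul_pow hq ha b c d (norm_circleMap_zero_one θ)]
    ring
  -- By the closed form of the integral, the shift produces exactly the reciprocal of this quotient,
  -- so the result is independent of `n`.
  have hint : ∀ n : ℕ, (qPoch q (a * b * c * d) n /
          (qPoch q (a * b) n * qPoch q (a * c) n * qPoch q (a * d) n)) *
        ∫ θ in (0 : ℝ)..Real.pi, askeyWilsonKernel q (a * q ^ n) b c d (circleMap 0 1 θ) =
        ∫ θ in (0 : ℝ)..Real.pi, askeyWilsonKernel q a b c d (circleMap 0 1 θ) := fun n => by
    have key : ∀ u : ℂ, ‖u‖ < 1 → qPochInf q u = qPoch q u n * qPochInf q (u * q ^ n) ∧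
        qPoch q u n ≠ 0 ∧ qPochInf q (u * q ^ n) ≠ 0 := fun u hu => by
      have h1 := qPochInf_eq_qPoch_mul hq u n
      have h2 := qPochInf_ne_zero_of_norm_lt hq hu
      rw [h1] at h2
      exact ⟨h1, left_ne_zero_of_mul h2, right_ne_zero_of_mul h2⟩
    obtain ⟨b1, b2, b3⟩ := key _ (norm_mul_lt_one ha hb.le)
    obtain ⟨c1, c2, c3⟩ := key _ (norm_mul_lt_one ha hc.le)
    obtain ⟨d1, d2, d3⟩ := key _ (norm_mul_lt_one ha hd.le)
    obtain ⟨e1, e2, e3⟩ := key _ (norm_mul_mul_mul_lt_one ha hb hc hd)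
    have f1 := qPochInf_ne_zero_of_norm_lt hq (norm_mul_lt_one hb hc.le)
    have f2 := qPochInf_ne_zero_of_norm_lt hq (norm_mul_lt_one hb hd.le)
    have f3 := qPochInf_ne_zero_of_norm_lt hq (norm_mul_lt_one hc hd.le)
    have f4 := qPochInf_ne_zero_of_norm_lt hq hq
    rw [integral_askeyWilsonKernel hq0 hq1 (hn n) hb hc hd,
      integral_askeyWilsonKernel hq0 hq1 ha hb hc hd, b1, c1, d1, e1]
    simp only [mul_right_comm _ ((q : ℂ) ^ n) b, mul_right_comm _ ((q : ℂ) ^ n) c,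
      mul_right_comm _ ((q : ℂ) ^ n) d]
    generalize qPochInf q (a * b * q ^ n) = B at *
    generalize qPochInf q (a * c * q ^ n) = C at *
    generalize qPochInf q (a * d * q ^ n) = D at *
    generalize qPochInf q (a * b * c * d * q ^ n) = E at *
    generalize qPoch q (a * b) n = B' at *
    generalize qPoch q (a * c) n = C' at *
    generalize qPoch q (a * d) n = D' at *
    generalize qPoch q (a * b * c * d) n = E' at *
    field_simp
  have hcont : ∀ n : ℕ, Continuous fun θ : ℝ =>
      askeyWilsonKernel q (a * q ^ n) b c d (circleMap 0 1 θ) := fun n =>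
    continuous_askeyWilsonKernel_circleMap hq (hn n) hb hc hd
  simp only [hpt]
  rw [intervalIntegral.integral_finsetSum fun n _ =>
    ((hcont n).const_mul _).intervalIntegrable _ _]
  simp only [intervalIntegral.integral_const_mul, mul_assoc _ (qPoch _ _ _ / _), hint]
  rw [← Finset.sum_mul]
  split_ifs with hk
  · subst hk
    simp [qBinomCoeff]
  -- What remains is the `q`-binomial sum at `z = q`, the case `m = 0`.
  · have := sum_qBinomCoeff_mul_pow_eq_zero hq hqz (Nat.pos_of_ne_zero hk)
    rw [zero_add, pow_one] at this
    rw [this, zero_mul]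

end TerminatingSeries

/-! ### Growth of the coefficients and translation to the stated notation. -/

noncomputable section FractionalSeries

open Filter Topology


theorem tendsto_ofReal_cpow_add_natCast {q : ℝ} (hq0 : 0 < q) (hq1 : q < 1) (s : ℂ) :
    Tendsto (fun k : ℕ => (q : ℂ) ^ (s + k)) atTop (𝓝 0) := by
  have hq : ‖(q : ℂ)‖ < 1 := by simpa [abs_of_pos hq0]
  have hqz : (q : ℂ) ≠ 0 := by exact_mod_cast hq0.ne'
  simp only [Complex.cpow_add _ _ hqz, Complex.cpow_natCast]
  simpa using (tendsto_pow_atTop_nhds_zero_of_norm_lt_one hq).const_mul ((q : ℂ) ^ s)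

/-- The denominator tends to `(0; q)_∞ = 1`. -/
theorem tendsto_qPochGen_add_natCast {q : ℝ} (hq0 : 0 < q) (hq1 : q < 1) (u s : ℂ) :
    Tendsto (fun k : ℕ => qPochGen q u (s + k)) atTop (𝓝 (qPochInf q u)) := by
  have hq : ‖(q : ℂ)‖ < 1 := by simpa [abs_of_pos hq0]
  have h0 : Tendsto (fun k : ℕ => u * (q : ℂ) ^ (s + k)) atTop (𝓝 0) := by
    simpa using (tendsto_ofReal_cpow_add_natCast hq0 hq1 s).const_mul u
  have h1 := ((continuous_qPochInf hq).tendsto 0).comp h0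
  rw [qPochInf_zero] at h1
  simpa [qPochGen] using! (tendsto_const_nhds (x := qPochInf q u)).div h1 one_ne_zero

/-- The factors multiplying the `₄φ₃` in the series are `O((x / a)^k)`. -/
theorem exists_norm_fractionalCoeff_le {q : ℝ} (hq0 : 0 < q) (hq1 : q < 1) (α a : ℂ) {x : ℂ}
    (hx0 : x ≠ 0) :
    ∃ C, 0 ≤ C ∧ ∀ k : ℕ,
      ‖x ^ (α + k) * qPochGen q (a / x) (α + k) / (a ^ k * qPochGen q q (α + k))‖ ≤
        C * (‖x‖ / ‖a‖) ^ k := by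
  have hq : ‖(q : ℂ)‖ < 1 := by simpa [abs_of_pos hq0]
  have h := (tendsto_qPochGen_add_natCast hq0 hq1 (a / x) α).div
    (tendsto_qPochGen_add_natCast hq0 hq1 q α) (qPochInf_ne_zero_of_norm_lt hq hq)
  obtain ⟨C, hC⟩ := (Metric.isBounded_range_of_tendsto _ h).exists_norm_le
  have hC' : ∀ k : ℕ, ‖qPochGen q (a / x) (α + k) / qPochGen q q (α + k)‖ ≤ C := fun k =>
    hC _ ⟨k, rfl⟩
  refine ⟨‖x ^ α‖ * C, mul_nonneg (norm_nonneg _) ((norm_nonneg _).trans (hC' 0)), fun k => ?_⟩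
  rw [Complex.cpow_add _ _ hx0, Complex.cpow_natCast]
  calc _ = ‖x ^ α‖ * ‖qPochGen q (a / x) (α + k) / qPochGen q q (α + k)‖ * (‖x‖ / ‖a‖) ^ k := by
        simp only [norm_div, norm_mul, norm_pow, div_pow]
        rw [mul_div_mul_comm]
        ring
    _ ≤ _ := by
        gcongr
        exact hC' k

theorem exp_I_mul_eq_circleMap (θ : ℝ) :
    Complex.exp (Complex.I * θ) = circleMap 0 1 θ := by
  rw [circleMap_zero, Complex.ofReal_one, one_mul, mul_comm]

theorem exp_neg_I_mul_eq_circleMap_inv (θ : ℝ) :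
    Complex.exp (-(Complex.I * θ)) = (circleMap 0 1 θ)⁻¹ := by
  rw [Complex.exp_neg, exp_I_mul_eq_circleMap]

theorem askeyWilsonH_div_eq_kernel (q a b c d : ℂ) (θ : ℝ) :
    askeyWilsonH q (2 * θ) [1] / askeyWilsonH q θ [a, b, c, d] =
      askeyWilsonKernel q a b c d (circleMap 0 1 θ) := by
  have h : Complex.exp (Complex.I * (2 * θ : ℝ)) = circleMap 0 1 θ ^ 2 := by
    rw [← exp_I_mul_eq_circleMap, ← Complex.exp_nat_mul]
    congr 1
    push_cast
    ring
  simp only [askeyWilsonH, qPochInfList, askeyWilsonKernel, askeyWilsonFactor, List.map_cons,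
    List.map_nil, List.prod_cons, List.prod_nil, mul_one, one_mul, Complex.exp_neg, h,
    exp_I_mul_eq_circleMap, inv_pow]
  simp only [mul_assoc]

theorem fractionalAskeyWilsonTerm_eq {q : ℂ} (hq0 : q ≠ 0) (α : ℝ) (x a b c d : ℂ) (θ : ℝ)
    (k : ℕ) :
    fractionalAskeyWilsonTerm q α x a b c d θ k =
      x ^ ((α : ℂ) + k) * qPochGen q (a / x) (α + k) / (a ^ k * qPochGen q q (α + k)) *
        terminatingPhi q a b c d k (circleMap 0 1 θ) := by
  rw [fractionalAskeyWilsonTerm, exp_neg_I_mul_eq_circleMap_inv, exp_I_mul_eq_circleMap,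
    basicHypergeometric_eq_terminatingPhi hq0]

end FractionalSeries

/-! ### Termwise integration of the series. -/

theorem mainTheorem2 (q α : ℝ) (hq0 : 0 < q) (hq1 : q < 1) (hα : 0 < α)
    (a b c d x : ℂ) (hmax : max (max ‖a‖ ‖b‖) (max ‖c‖ ‖d‖) < 1)
    (ha : a ≠ 0) (hx0 : x ≠ 0) (hx1 : ‖x‖ < 1)
    (hpole : ∀ n : ℕ, a / x * (q : ℂ) ^ ((α : ℂ) + n) ≠ 1) :
    (∀ θ ∈ Set.Icc (0 : ℝ) Real.pi,
      Summable fun k : ℕ => fractionalAskeyWilsonTerm q α x a b c d θ k) ∧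
    IntervalIntegrable
      (fun θ : ℝ => askeyWilsonH q (2 * θ) [1] / askeyWilsonH q θ [a, b, c, d] *
        ∑' k : ℕ, fractionalAskeyWilsonTerm q α x a b c d θ k)
      MeasureTheory.volume 0 Real.pi ∧
    ∫ θ in (0 : ℝ)..Real.pi,
        askeyWilsonH q (2 * θ) [1] / askeyWilsonH q θ [a, b, c, d] *
          ∑' k : ℕ, fractionalAskeyWilsonTerm q α x a b c d θ k =
      2 * (Real.pi : ℂ) * qPochInf q (a * b * c * d) /
          qPochInfList q [(q : ℂ), a * b, a * c, a * d, b * c, b * d, c * d] *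
        (x ^ (α : ℂ) * qPochGen q (a / x) α / qPochGen q q α) := by
  have hq : ‖(q : ℂ)‖ < 1 := by simpa [abs_of_pos hq0]
  have hqz : (q : ℂ) ≠ 0 := by exact_mod_cast hq0.ne'
  obtain ⟨⟨ha1, hb1⟩, hc1, hd1⟩ : (‖a‖ < 1 ∧ ‖b‖ < 1) ∧ ‖c‖ < 1 ∧ ‖d‖ < 1 := by
    simpa only [max_lt_iff] using hmax
  -- `|a| < ρ < 1` gives the decay of the `₄φ₃`; `|x| < ρ` makes the product of the two bounds,
  -- `(|x|/|a|)^k (|a|/ρ)^k`, summable.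
  obtain ⟨ρ, hρ, hρ1⟩ := exists_between (max_lt ha1 hx1)
  obtain ⟨haρ, hxρ⟩ := max_lt_iff.1 hρ
  have hρ0 : 0 < ρ := (norm_nonneg a).trans_lt haρ
  have ha0 : 0 < ‖a‖ := norm_pos_iff.2 ha
  obtain ⟨C₁, hC₁, h₁⟩ := exists_norm_fractionalCoeff_le hq0 hq1 α a hx0
  obtain ⟨C₂, h₂⟩ := exists_norm_terminatingPhi_le hq0 hq1 hb1 hc1 hd1 haρ hρ1
  set κ : ℕ → ℂ := fun k =>
    x ^ ((α : ℂ) + k) * qPochGen q (a / x) (α + k) / (a ^ k * qPochGen q q (α + k)) with hκ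
  set K : ℝ → ℂ := fun θ => askeyWilsonKernel q a b c d (circleMap 0 1 θ) with hK
  set T : ℕ → ℝ → ℂ := fun k θ => κ k * terminatingPhi q a b c d k (circleMap 0 1 θ) with hT
  have hTeq : ∀ θ k, fractionalAskeyWilsonTerm q α x a b c d θ k = T k θ := fun θ k =>
    fractionalAskeyWilsonTerm_eq hqz α x a b c d θ k
  have hKcont : Continuous K := continuous_askeyWilsonKernel_circleMap hq ha1 hb1 hc1 hd1
  have hTcont : ∀ k, Continuous (T k) := fun k =>
    (continuous_terminatingPhi_circleMap q a b c d k).const_mul _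
  have hTbound : ∀ k θ, ‖T k θ‖ ≤ C₁ * C₂ * (‖x‖ / ρ) ^ k := fun k θ => by
    rw [hT, norm_mul]
    refine (mul_le_mul (h₁ k) (h₂ k _ (norm_circleMap_zero_one θ)) (norm_nonneg _)
      (by positivity)).trans_eq ?_
    rw [mul_mul_mul_comm, ← mul_pow, div_mul_div_cancel₀ ha0.ne']
  have hsum : Summable fun k : ℕ => C₁ * C₂ * (‖x‖ / ρ) ^ k :=
    (summable_geometric_of_lt_one (by positivity) ((div_lt_one hρ0).2 hxρ)).mul_left _
  have hTsum : ∀ θ, Summable fun k => T k θ := fun θ => hsum.of_norm_bounded fun k => hTbound k θ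
  simp only [askeyWilsonH_div_eq_kernel, hTeq]
  refine ⟨fun θ _ => hTsum θ,
    (hKcont.mul (continuous_tsum hTcont hsum hTbound)).intervalIntegrable _ _, ?_⟩
  have hS : HasSum (fun k => ∫ θ in (0 : ℝ)..Real.pi, K θ * T k θ)
      (∫ θ in (0 : ℝ)..Real.pi, K θ * ∑' k, T k θ) := by
    refine intervalIntegral.hasSum_integral_of_dominated_convergence
      (fun k θ => ‖K θ‖ * (C₁ * C₂ * (‖x‖ / ρ) ^ k))
      (fun k => (hKcont.mul (hTcont k)).aestronglyMeasurable)
      (fun k => Filter.Eventually.of_forall fun θ _ => ?_)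
      (Filter.Eventually.of_forall fun θ _ => hsum.mul_left _) ?_
      (Filter.Eventually.of_forall fun θ _ => (hTsum θ).hasSum.mul_left _)
    · rw [norm_mul]
      exact mul_le_mul_of_nonneg_left (hTbound k θ) (norm_nonneg _)
    · simp only [tsum_mul_left]
      exact (hKcont.norm.mul continuous_const).intervalIntegrable _ _
  -- Orthogonality leaves only `κ 0`, which is the factor `x^α (a/x;q)_α / (q;q)_α` of the answer.
  have hterm : ∀ k, ∫ θ in (0 : ℝ)..Real.pi, K θ * T k θ =
      if k = 0 then κ 0 * ∫ θ in (0 : ℝ)..Real.pi, K θ else 0 := fun k => by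
    simp only [hT, mul_left_comm (K _)]
    rw [intervalIntegral.integral_const_mul,
      integral_askeyWilsonKernel_mul_terminatingPhi hq0 hq1 ha1 hb1 hc1 hd1]
    split_ifs with hk
    · rw [hk]
    · rw [mul_zero]
  simp only [hterm] at hS
  rw [hS.unique (hasSum_ite_eq 0 _), integral_askeyWilsonKernel hq0 hq1 ha1 hb1 hc1 hd1]
  simp [hκ, qPochInfList, mul_comm, mul_left_comm]
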